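/- Let $G$ be a (finite-dimensional, real) Lie group with identity $e$, carrying a bi-invariant Riemannian or pseudo-Riemannian metric $h$, and give $D=G\times G$ the product metric $h\oplus h$, which is again bi-invariant. Let $m:G\times G\to G$, $m(x,y)=xy$, and for $(x,y)\in D$ let $$\mathcal O_{(x,y)}=\{(w x v^{-1},\,v y w^{-1}) : w,v\in G\}$$ be its twisted conjugacy class, i.e. its orbit under the twisted adjoint action of $D$ on itself. Let $\Delta^-=\{(x,x^{-1}) : x\in G\}$ be the anti-diagonal. **Theorem.** Let $z\in G$ be central. Then $$\mathcal O_{(e,z)}=m^{-1}(z)=\{(x,x^{-1}z) : x\in G\}=(e,z)\cdot\Delta^-=\Delta^-\cdot(e,z),$$ so $\mathcal O_{(e,z)}$ is both a left and a right translate of the anti-diagonal. The map $x\mapsto(x,x^{-1}z)$ is a smooth embedding of $G$ into $D$ with image $\mathcal O_{(e,z)}$, the metric $h\oplus h$ is nondegenerate on $\mathcal O_{(e,z)}$, and the submanifold $\mathcal O_{(e,z)}$ of $(D,h\oplus h)$ is totally geodesic (its second fundamental form with respect to the Levi-Civita connection vanishes) and, in particular, minimal (the trace of its second fundamental form vanishes).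 In particular, let $G=\mathrm{SU}(2)$ with any bi-invariant metric $h$. Then $\mathcal O_{(e,e)}$ and $\mathcal O_{(e,-e)}$ are totally geodesic (and minimal) $3$-spheres in $(\mathrm{SU}(2)\times\mathrm{SU}(2),\,h\oplus h)$: each of them is the image of a smooth, totally geodesic embedding of $S^3$. -/

import Mathlib

open scoped Manifold ContDiff Matrix
open Metric Bundle Filter Topology

universe u v

section PseudoRiemannian

variable {E : Type*} [NormedAddCommGroup E] [NormedSpace ℝ E]
  {H : Type*} [TopologicalSpace H]

/-- A smooth pseudo-Riemannian metric on `M`: a smooth field of nondegenerate symmetric bilinear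
forms on the tangent spaces. No signature is prescribed, so Riemannian metrics are included. -/
structure PseudoRiemannianMetric (I : ModelWithCorners ℝ E H)
    (M : Type*) [TopologicalSpace M] [ChartedSpace H M] [IsManifold I 1 M] where
  /-- The bilinear form on each tangent space. -/
  inner (x : M) : TangentSpace I x →L[ℝ] TangentSpace I x →L[ℝ] ℝ
  symm (x : M) (v w : TangentSpace I x) : inner x v w = inner x w v
  nondegenerate (x : M) (v : TangentSpace I x) (hv : ∀ w, inner x v w = 0) : v = 0
  contMDiff : ContMDiff I (I.prod 𝓘(ℝ, E →L[ℝ] E →L[ℝ] ℝ)) ∞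
    (fun x ↦ TotalSpace.mk' (E →L[ℝ] E →L[ℝ] ℝ)
      (E := fun x : M ↦ TangentSpace I x →L[ℝ] TangentSpace I x →L[ℝ] ℝ) x (inner x))

variable {I : ModelWithCorners ℝ E H}
  {M : Type*} [TopologicalSpace M] [ChartedSpace H M]
  {E' : Type*} [NormedAddCommGroup E'] [NormedSpace ℝ E']
  {H' : Type*} [TopologicalSpace H'] {J : ModelWithCorners ℝ E' H'}
  {N : Type*} [TopologicalSpace N] [ChartedSpace H' N]

/-- A Riemannian metric is a pseudo-Riemannian metric. -/
def PseudoRiemannianMetric.ofRiemannian [IsManifold I 1 M]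
    (g : ContMDiffRiemannianMetric I ∞ E (fun x : M ↦ TangentSpace I x)) :
    PseudoRiemannianMetric I M where
  inner := g.inner
  symm := g.symm
  nondegenerate x v hv := by
    by_contra h
    exact (g.pos x v h).ne' (hv v)
  contMDiff := g.contMDiff

/-- The pullback `f^* b` of a field of bilinear forms: `(f^* b)(v, w) = b(df v, df w)`. -/
noncomputable def pullbackForm (J : ModelWithCorners ℝ E' H') (I : ModelWithCorners ℝ E H)
    (f : N → M) (b : ∀ x : M, TangentSpace I x →L[ℝ] TangentSpace I x →L[ℝ] ℝ) (x : N) :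
    TangentSpace J x →L[ℝ] TangentSpace J x →L[ℝ] ℝ :=
  (ContinuousLinearMap.precomp ℝ (mfderiv J I f x)).comp ((b (f x)).comp (mfderiv J I f x))

theorem pullbackForm_apply (f : N → M)
    (b : ∀ x : M, TangentSpace I x →L[ℝ] TangentSpace I x →L[ℝ] ℝ) (x : N)
    (v w : TangentSpace J x) :
    pullbackForm J I f b x v w = b (f x) (mfderiv J I f x v) (mfderiv J I f x w) := rfl

variable [IsManifold I 1 M] [IsManifold J 1 N]

theorem contMDiff_pullbackForm {f : N → M} (hf : ContMDiff J I ∞ f)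
    {b : ∀ x : M, TangentSpace I x →L[ℝ] TangentSpace I x →L[ℝ] ℝ}
    (hb : ContMDiff I (I.prod 𝓘(ℝ, E →L[ℝ] E →L[ℝ] ℝ)) ∞
    (fun x ↦ TotalSpace.mk' (E →L[ℝ] E →L[ℝ] ℝ)
      (E := fun x : M ↦ TangentSpace I x →L[ℝ] TangentSpace I x →L[ℝ] ℝ) x (b x))) :
    ContMDiff J (J.prod 𝓘(ℝ, E' →L[ℝ] E' →L[ℝ] ℝ)) ∞
    (fun x ↦ TotalSpace.mk' (E' →L[ℝ] E' →L[ℝ] ℝ)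
      (E := fun x : N ↦ TangentSpace J x →L[ℝ] TangentSpace J x →L[ℝ] ℝ) x (pullbackForm J I f b x)) := by
  intro x₀
  rw [contMDiffAt_hom_bundle]
  refine ⟨contMDiffAt_id, ?_⟩
  have h1 := hf x₀
  have h2 : ContMDiffAt J 𝓘(ℝ, E' →L[ℝ] E) ∞
      (inTangentCoordinates J I id f (mfderiv J I f) x₀) x₀ := h1.mfderiv_const le_rfl
  have h3 := ((contMDiffAt_hom_bundle _).1 (hb (f x₀))).2.comp x₀ h1
  have h4 := (h2.clm_precomp (F₃ := ℝ)).clm_comp (h3.clm_comp h2)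
  refine h4.congr_of_eventuallyEq ?_
  have hU := (chartAt H' x₀).open_source.mem_nhds (mem_chart_source H' x₀)
  have hV := h1.continuousAt.preimage_mem_nhds
    ((chartAt H (f x₀)).open_source.mem_nhds (mem_chart_source H (f x₀)))
  filter_upwards [hU, hV] with x hx hx'
  ext v w
  have hx1 : x ∈ (trivializationAt E' (TangentSpace J) x₀).baseSet := by
    simpa using hx
  have hx2 : f x ∈ (trivializationAt E (TangentSpace I) (f x₀)).baseSet := by
    simpa using hx'
  have e1 := inCoordinates_apply_eq₂ (𝕜 := ℝ) (F₁ := E') (F₂ := E') (F₃ := ℝ)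
    (E₁ := (TangentSpace J : N → Type _)) (E₂ := (TangentSpace J : N → Type _))
    (E₃ := Bundle.Trivial N ℝ) (ϕ := pullbackForm J I f b x) (v := v) (w := w) hx1 hx1
    (Set.mem_univ _)
  have key : ∀ v : E', (trivializationAt E (TangentSpace I) (f x₀)).symm (f x)
      (inTangentCoordinates J I id f (mfderiv J I f) x₀ x v) =
      mfderiv J I f x ((trivializationAt E' (TangentSpace J) x₀).symm x v) := by
    intro v
    have h := congrArg (fun L : E' →L[ℝ] E ↦ L v)
      (ContinuousLinearMap.inCoordinates_eq (ϕ := mfderiv J I f x) hx1 hx2)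
    have h' : inTangentCoordinates J I id f (mfderiv J I f) x₀ x v =
      (trivializationAt E (TangentSpace I) (f x₀)).continuousLinearEquivAt ℝ (f x) hx2
        (mfderiv J I f x ((trivializationAt E' (TangentSpace J) x₀).symm x v)) := by
      exact h
    rw [h']
    exact ((trivializationAt E (TangentSpace I) (f x₀)).continuousLinearEquivAt ℝ (f x)
      hx2).symm_apply_apply _
  have e2 := inCoordinates_apply_eq₂ (𝕜 := ℝ) (F₁ := E) (F₂ := E) (F₃ := ℝ)
    (E₁ := (TangentSpace I : M → Type _)) (E₂ := (TangentSpace I : M → Type _))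
    (E₃ := Bundle.Trivial M ℝ) (ϕ := b (f x))
    (v := inTangentCoordinates J I id f (mfderiv J I f) x₀ x v)
    (w := inTangentCoordinates J I id f (mfderiv J I f) x₀ x w) hx2 hx2
    (Set.mem_univ _)
  rw [key, key] at e2
  exact e1.trans e2.symm

set_option synthInstance.maxHeartbeats 200000 in
/-- The product metric `pr₁^* g + pr₂^* h` on `M × N`. -/
noncomputable def PseudoRiemannianMetric.prod (g : PseudoRiemannianMetric I M)
    (h : PseudoRiemannianMetric J N) : PseudoRiemannianMetric (I.prod J) (M × N) where
  inner p := pullbackForm (I.prod J) I Prod.fst g.inner p +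
    pullbackForm (I.prod J) J Prod.snd h.inner p
  symm p v w := by
    change g.inner p.1 _ _ + h.inner p.2 _ _ = g.inner p.1 _ _ + h.inner p.2 _ _
    rw [g.symm, h.symm]
  nondegenerate p v hv := by
    have hv' (w : E × E') : g.inner p.1 v.1 w.1 + h.inner p.2 v.2 w.2 = 0 := by
      have := hv w
      change g.inner p.1 (mfderiv (I.prod J) I Prod.fst p v) (mfderiv (I.prod J) I Prod.fst p w) +
        h.inner p.2 (mfderiv (I.prod J) J Prod.snd p v) (mfderiv (I.prod J) J Prod.snd p w) = 0
        at this
      rw [mfderiv_fst, mfderiv_snd] at this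
      exact this
    have h1 : v.1 = 0 := g.nondegenerate p.1 v.1 fun w ↦ by
      have := hv' (w, 0)
      rwa [show h.inner p.2 v.2 ((w, 0) : E × E').2 = 0 from map_zero _, add_zero] at this
    have h2 : v.2 = 0 := h.nondegenerate p.2 v.2 fun w ↦ by
      have := hv' (0, w)
      rwa [show g.inner p.1 v.1 ((0, w) : E × E').1 = 0 from map_zero _, zero_add] at this
    exact Prod.ext h1 h2
  contMDiff := (contMDiff_pullbackForm contMDiff_fst g.contMDiff).add_section
    (contMDiff_pullbackForm contMDiff_snd h.contMDiff)

/-- `D` is the Levi-Civita connection of `g`: it is torsion-free, `∇_X Y - ∇_Y X = [X, Y]`, and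
metric, `v g(Y, Z) = g(∇_v Y, Z) + g(Y, ∇_v Z)`. In Mathlib's order of arguments `D Y x v` is the
value at `x` of `∇_v Y`. -/
structure IsLeviCivita (g : PseudoRiemannianMetric I M)
    (D : CovariantDerivative I E (fun x : M ↦ TangentSpace I x)) : Prop where
  torsionFree (x : M) (X Y : ∀ x : M, TangentSpace I x)
    (hX : MDiffAt (T% X) x) (hY : MDiffAt (T% Y) x) :
    D Y x (X x) - D X x (Y x) = VectorField.mlieBracket I X Y x
  metric (x : M) (v : TangentSpace I x) (Y Z : ∀ x : M, TangentSpace I x)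
    (hY : MDiffAt (T% Y) x) (hZ : MDiffAt (T% Z) x) :
    mvfderiv I (fun y ↦ g.inner y (Y y) (Z y)) x v =
      g.inner x (D Y x v) (Z x) + g.inner x (Y x) (D Z x v)

/-- `f : N → M` is a smooth embedding on whose image the metric of `M` is nondegenerate, so that its
image is a pseudo-Riemannian (Riemannian, if `M` is Riemannian) embedded submanifold of `M`. -/
structure IsNondegenerateEmbedding (J : ModelWithCorners ℝ E' H')
    (g : PseudoRiemannianMetric I M) (f : N → M) : Prop where
  isSmoothEmbedding : Manifold.IsSmoothEmbedding J I ∞ f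
  nondegenerate (p : N) (v : TangentSpace J p)
    (hv : ∀ w, pullbackForm J I f g.inner p v w = 0) : v = 0

/-- `B` is the second fundamental form of the immersion `f` into `M`, where `D` is the Levi-Civita
connection of `(M, g)`: `B(v, w)` is the component normal to `f` of `∇_{df v} Y`, for every local
vector field `Y` of `M` that is tangent to `f` along `f` and extends `df w`. -/
structure IsSecondFundamentalForm (J : ModelWithCorners ℝ E' H') (g : PseudoRiemannianMetric I M)
    (D : CovariantDerivative I E (fun x : M ↦ TangentSpace I x)) (f : N → M)
    (B : ∀ p : N, TangentSpace J p → TangentSpace J p → TangentSpace I (f p)) : Prop where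
  normal (p : N) (v w u : TangentSpace J p) : g.inner (f p) (B p v w) (mfderiv J I f p u) = 0
  gauss (p : N) (v w : TangentSpace J p) (Y : ∀ x : M, TangentSpace I x)
    (hY : CMDiffAt ∞ (T% Y) (f p))
    (hYtangent : ∀ᶠ q in 𝓝 p, ∃ u : TangentSpace J q, Y (f q) = mfderiv J I f q u)
    (hYw : Y (f p) = mfderiv J I f p w) :
    ∃ u : TangentSpace J p, D Y (f p) (mfderiv J I f p v) = mfderiv J I f p u + B p v w

/-- `f` is a totally geodesic embedding: its second fundamental form vanishes. -/
def IsTotallyGeodesic (J : ModelWithCorners ℝ E' H') (g : PseudoRiemannianMetric I M)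
    (f : N → M) : Prop :=
  IsNondegenerateEmbedding J g f ∧
    ∃ D, IsLeviCivita g D ∧ IsSecondFundamentalForm J g D f fun _ _ _ ↦ 0

/-- `f` is a minimal embedding: the trace of its second fundamental form with respect to the induced
metric, which is a multiple of the mean curvature vector, vanishes. The trace of a bilinear form `B`
is the sum of the `B(bᵢ, cᵢ)` over two dual bases `b`, `c` (an orthonormal basis is dual to itself
in the Riemannian case). -/
def IsMinimal (J : ModelWithCorners ℝ E' H') (g : PseudoRiemannianMetric I M)
    (f : N → M) : Prop :=
  IsNondegenerateEmbedding J g f ∧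
    ∃ D B, IsLeviCivita g D ∧ IsSecondFundamentalForm J g D f B ∧
      ∀ (p : N) (b c : Module.Basis (Fin (Module.finrank ℝ E')) ℝ (TangentSpace J p)),
        (∀ i j, pullbackForm J I f g.inner p (b i) (c j) = if i = j then 1 else 0) →
          ∑ i, B p (b i) (c i) = 0

end PseudoRiemannian

section TwistedConjugacy

/-- The twisted adjoint action of `G × G` on itself by `(x, y) · (x₀, y₀) = (x x₀ y⁻¹, y y₀ x⁻¹)`. -/
def twistedAd {G : Type*} [Group G] (u p : G × G) : G × G :=
  (u.1 * p.1 * u.2⁻¹, u.2 * p.2 * u.1⁻¹)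

/-- The twisted conjugacy class of `p`, its orbit under the twisted adjoint action. -/
def twistedConjClass {G : Type*} [Group G] (p : G × G) : Set (G × G) :=
  Set.range fun u ↦ twistedAd u p

/-- The anti-diagonal `{(x, x⁻¹)}` of `G × G`. -/
def antiDiagonal (G : Type*) [Group G] : Set (G × G) :=
  Set.range fun x : G ↦ (x, x⁻¹)

/-- A metric on a Lie group is bi-invariant if all left and all right translations are isometries. -/
structure IsBiInvariant {E : Type*} [NormedAddCommGroup E] [NormedSpace ℝ E]
    {H : Type*} [TopologicalSpace H] {I : ModelWithCorners ℝ E H}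
    {G : Type*} [TopologicalSpace G] [ChartedSpace H G] [Group G] [IsManifold I 1 G]
    (h : PseudoRiemannianMetric I G) : Prop where
  left (a : G) : pullbackForm I I (fun x ↦ a * x) h.inner = h.inner
  right (a : G) : pullbackForm I I (fun x ↦ x * a) h.inner = h.inner

end TwistedConjugacy

section SpecialUnitary

/-- The group `SU(2)` of unitary `2 × 2` complex matrices of determinant one. -/
abbrev SU2 : Type := Matrix.specialUnitaryGroup (Fin 2) ℂ
/-- The unit sphere of `ℝ⁴`, with its standard smooth structure. -/
abbrev S3 : Type := sphere (0 : EuclideanSpace ℝ (Fin 4)) 1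

namespace SU2

/-- First row of a matrix, as a vector of `ℝ⁴`. -/
noncomputable def coords (A : Matrix (Fin 2) (Fin 2) ℂ) : EuclideanSpace ℝ (Fin 4) :=
  !₂[(A 0 0).re, (A 0 0).im, (A 0 1).re, (A 0 1).im]

/-- The matrix with rows `(a + bi, c + di)` and `(-c + di, a - bi)`. -/
noncomputable def ofCoords (x : EuclideanSpace ℝ (Fin 4)) : Matrix (Fin 2) (Fin 2) ℂ :=
  !![⟨x 0, x 1⟩, ⟨x 2, x 3⟩; ⟨-x 2, x 3⟩, ⟨x 0, -x 1⟩]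

theorem mem_sphere_iff (x : EuclideanSpace ℝ (Fin 4)) :
    x ∈ sphere (0 : EuclideanSpace ℝ (Fin 4)) 1 ↔
      x 0 ^ 2 + x 1 ^ 2 + x 2 ^ 2 + x 3 ^ 2 = 1 := by
  rw [mem_sphere_zero_iff_norm, EuclideanSpace.norm_eq, Real.sqrt_eq_one, Fin.sum_univ_four]
  simp

theorem entries (A : SU2) :
    A.1 1 0 = -star (A.1 0 1) ∧ A.1 1 1 = star (A.1 0 0) := by
  have hadj : A.1.adjugate = star A.1 := by
    have h1 : star A.1 * A.1 = 1 := A.2.1.1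
    have h2 : A.1 * A.1.adjugate = 1 := by
      rw [Matrix.mul_adjugate, show A.1.det = 1 from A.2.2, one_smul]
    calc A.1.adjugate = (star A.1 * A.1) * A.1.adjugate := by rw [h1, one_mul]
      _ = star A.1 := by rw [mul_assoc, h2, mul_one]
  rw [Matrix.adjugate_fin_two] at hadj
  constructor
  · have := congrFun (congrFun hadj 1) 0
    simp [Matrix.star_apply] at this
    simp [← this]
  · have := congrFun (congrFun hadj 0) 0
    simpa [Matrix.star_apply] using this

theorem coords_mem (A : SU2) : coords A.1 ∈ sphere (0 : EuclideanSpace ℝ (Fin 4)) 1 := by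
  rw [mem_sphere_iff]
  have h : A.1.det = 1 := A.2.2
  rw [Matrix.det_fin_two, (entries A).1, (entries A).2] at h
  have := congrArg Complex.re h
  simp [coords] at this ⊢
  nlinarith

theorem ofCoords_mem (x : S3) : ofCoords x.1 ∈ Matrix.specialUnitaryGroup (Fin 2) ℂ := by
  have h := (mem_sphere_iff x.1).1 x.2
  rw [Matrix.mem_specialUnitaryGroup_iff, Matrix.mem_unitaryGroup_iff]
  constructor
  · ext i j
    fin_cases i <;> fin_cases j <;>
      simp [ofCoords, Matrix.mul_apply, Fin.sum_univ_two, Matrix.star_apply, Complex.ext_iff] <;>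
      constructor <;> nlinarith
  · simp [ofCoords, Matrix.det_fin_two, Complex.ext_iff]
    constructor <;> nlinarith

theorem continuous_coords : Continuous coords := by
  unfold coords
  refine (PiLp.continuous_toLp 2 _).comp (continuous_pi fun i ↦ ?_)
  fin_cases i <;> simp <;> fun_prop

theorem continuous_ofCoords : Continuous ofCoords := by
  have h : ofCoords = fun x ↦ !![(x 0 : ℂ) + x 1 * Complex.I, x 2 + x 3 * Complex.I;
      -x 2 + x 3 * Complex.I, x 0 - x 1 * Complex.I] := by
    funext x
    ext i j
    fin_cases i <;> fin_cases j <;> simp [ofCoords, Complex.ext_iff]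
  rw [h]
  refine continuous_matrix fun i j ↦ ?_
  fin_cases i <;> fin_cases j <;> simp <;> fun_prop

/-- The homeomorphism of `SU(2)`, with the topology induced from the space of matrices, onto `S³`
given by the first row of a matrix. -/
noncomputable def homeoSphere : SU2 ≃ₜ S3 where
  toFun A := ⟨coords A.1, coords_mem A⟩
  invFun x := ⟨ofCoords x.1, ofCoords_mem x⟩
  left_inv A := by
    apply Subtype.ext
    ext i j
    have h := entries A
    fin_cases i <;> fin_cases j <;> simp [ofCoords, coords, Complex.ext_iff, h]
  right_inv x := by
    apply Subtype.ext
    ext i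
    fin_cases i <;> simp [ofCoords, coords]
  continuous_toFun := (continuous_coords.comp continuous_subtype_val).subtype_mk _
  continuous_invFun := (continuous_ofCoords.comp continuous_subtype_val).subtype_mk _

/-- The charts of `SU(2)` are those of `S³`, transported along `homeoSphere`. -/
noncomputable instance : ChartedSpace (EuclideanSpace ℝ (Fin 3)) SU2 where
  atlas := homeoSphere.transOpenPartialHomeomorph '' atlas (EuclideanSpace ℝ (Fin 3)) S3
  chartAt A := homeoSphere.transOpenPartialHomeomorph (chartAt _ (homeoSphere A))
  mem_chart_source A := by simp
  chart_mem_atlas A := Set.mem_image_of_mem _ (chart_mem_atlas _ _)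

theorem chartAt_eq (A : SU2) : chartAt (EuclideanSpace ℝ (Fin 3)) A =
    homeoSphere.transOpenPartialHomeomorph (chartAt _ (homeoSphere A)) := rfl

instance : IsManifold (𝓡 3) ∞ SU2 where
  compatible := by
    rintro _ _ ⟨e, he, rfl⟩ ⟨e', he', rfl⟩
    have := (contDiffGroupoid ∞ (𝓡 3)).compatible he he'
    convert this using 1
    ext x <;> simp

theorem contMDiff_homeoSphere : ContMDiff (𝓡 3) (𝓡 3) ∞ homeoSphere := by
  intro A
  rw [contMDiffAt_iff]
  refine ⟨homeoSphere.continuous.continuousAt, ?_⟩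
  have h := (contMDiffAt_iff.1 (contMDiffAt_id (I := 𝓡 3) (n := ∞) (x := homeoSphere A))).2
  convert h using 1
  · ext x
    simp [chartAt_eq]
  · simp [chartAt_eq]

theorem contMDiff_homeoSphere_symm : ContMDiff (𝓡 3) (𝓡 3) ∞ homeoSphere.symm := by
  intro x
  rw [contMDiffAt_iff]
  refine ⟨homeoSphere.symm.continuous.continuousAt, ?_⟩
  have h := (contMDiffAt_iff.1 (contMDiffAt_id (I := 𝓡 3) (n := ∞) (x := x))).2
  convert h using 1
  ext x
  simp [chartAt_eq]

theorem contMDiff_of_coords {E H N : Type*} [NormedAddCommGroup E] [NormedSpace ℝ E]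
    [TopologicalSpace H] {J : ModelWithCorners ℝ E H} [TopologicalSpace N] [ChartedSpace H N]
    [IsManifold J ∞ N]
    {f : N → SU2} (hf : ContMDiff J 𝓘(ℝ, EuclideanSpace ℝ (Fin 4)) ∞ fun x ↦ coords (f x).1) :
    ContMDiff J (𝓡 3) ∞ f := by
  have : Fact (Module.finrank ℝ (EuclideanSpace ℝ (Fin 4)) = 3 + 1) := ⟨by simp⟩
  have h := contMDiff_homeoSphere_symm.comp
    (hf.codRestrict_sphere (n := 3) fun x ↦ coords_mem (f x))
  convert h using 1
  funext x
  exact (homeoSphere.symm_apply_apply (f x)).symm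

theorem contMDiff_coord (i : Fin 4) :
    ContMDiff (𝓡 3) 𝓘(ℝ, ℝ) ∞ fun A : SU2 ↦ coords A.1 i := by
  have : Fact (Module.finrank ℝ (EuclideanSpace ℝ (Fin 4)) = 3 + 1) := ⟨by simp⟩
  have h : ContMDiff (𝓡 3) 𝓘(ℝ, EuclideanSpace ℝ (Fin 4)) ∞ fun A : SU2 ↦ coords A.1 :=
    (contMDiff_coe_sphere (E := EuclideanSpace ℝ (Fin 4)) (n := 3)).comp contMDiff_homeoSphere
  exact (EuclideanSpace.proj (𝕜 := ℝ) i).contDiff.contMDiff.comp h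

theorem contMDiff_toLp {E H N : Type*} [NormedAddCommGroup E] [NormedSpace ℝ E]
    [TopologicalSpace H] {J : ModelWithCorners ℝ E H} [TopologicalSpace N] [ChartedSpace H N]
    {f : N → EuclideanSpace ℝ (Fin 4)} (hf : ∀ i, ContMDiff J 𝓘(ℝ, ℝ) ∞ fun x ↦ f x i) :
    ContMDiff J 𝓘(ℝ, EuclideanSpace ℝ (Fin 4)) ∞ f := by
  have h : ContMDiff J 𝓘(ℝ, Fin 4 → ℝ) ∞ fun x i ↦ f x i := contMDiff_pi_space.2 hf
  exact (EuclideanSpace.equiv (Fin 4) ℝ).symm.contDiff.contMDiff.comp h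

/-- With this smooth structure `SU(2)` is a Lie group. -/
instance : LieGroup (𝓡 3) ∞ SU2 where
  contMDiff_mul := by
    apply contMDiff_of_coords
    have h1 (i : Fin 4) := (contMDiff_coord i).comp
      (contMDiff_fst (I := 𝓡 3) (J := 𝓡 3) (M := SU2) (N := SU2) (n := ∞))
    have h2 (i : Fin 4) := (contMDiff_coord i).comp
      (contMDiff_snd (I := 𝓡 3) (J := 𝓡 3) (M := SU2) (N := SU2) (n := ∞))
    refine contMDiff_toLp fun i ↦ ?_
    fin_cases i
    · refine (((((h1 0).mul (h2 0)).sub ((h1 1).mul (h2 1))).sub ((h1 2).mul (h2 2))).sub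
        ((h1 3).mul (h2 3))).congr fun p ↦ ?_
      simp [coords, Matrix.mul_apply, Fin.sum_univ_two, entries]
      ring
    · refine (((((h1 0).mul (h2 1)).add ((h1 1).mul (h2 0))).add ((h1 2).mul (h2 3))).sub
        ((h1 3).mul (h2 2))).congr fun p ↦ ?_
      simp [coords, Matrix.mul_apply, Fin.sum_univ_two, entries]
      ring
    · refine (((((h1 0).mul (h2 2)).sub ((h1 1).mul (h2 3))).add ((h1 2).mul (h2 0))).add
        ((h1 3).mul (h2 1))).congr fun p ↦ ?_
      simp [coords, Matrix.mul_apply, Fin.sum_univ_two, entries]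
      ring
    · refine (((((h1 0).mul (h2 3)).add ((h1 1).mul (h2 2))).sub ((h1 2).mul (h2 1))).add
        ((h1 3).mul (h2 0))).congr fun p ↦ ?_
      simp [coords, Matrix.mul_apply, Fin.sum_univ_two, entries]
      ring
  contMDiff_inv := by
    apply contMDiff_of_coords
    refine contMDiff_toLp fun i ↦ ?_
    fin_cases i
    · refine (contMDiff_coord 0).congr fun A ↦ ?_
      simp [coords, ← Matrix.star_eq_inv, Matrix.star_apply]
    · refine (contMDiff_coord 1).neg.congr fun A ↦ ?_
      simp [coords, ← Matrix.star_eq_inv, Matrix.star_apply]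
    · refine (contMDiff_coord 2).neg.congr fun A ↦ ?_
      simp [coords, ← Matrix.star_eq_inv, Matrix.star_apply, entries]
    · refine (contMDiff_coord 3).neg.congr fun A ↦ ?_
      simp [coords, ← Matrix.star_eq_inv, Matrix.star_apply, entries]

/-- The element `-e` of `SU(2)`. -/
noncomputable def negOne : SU2 :=
  ⟨-1, by
    rw [Matrix.mem_specialUnitaryGroup_iff, Matrix.mem_unitaryGroup_iff]
    simp [Matrix.det_fin_two]⟩

end SU2

end SpecialUnitary

/-! The tangent bundle of a Lie group has two trivializations, by left and by right translations,
and each defines a flat connection. A bi-invariant metric is constant in both, so both connections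
are metric, and so is their mean. The mean is also torsion-free. The geodesic symmetry `k ↦ x * k⁻¹
* x` fixes `x`, has derivative `-1` there and exchanges the two flat connections at `x`, so it
preserves the mean and hence its torsion at `x`. A bilinear map with vector values that is preserved
by `-1` is zero. The mean is therefore the Levi-Civita connection (`IsBiInvariant.isLeviCivita`),
also for the product metric on `G × G`, which is bi-invariant too.

Let `φ x = x⁻¹ * z` with `z` central. Since `φ` involves an inversion, its derivative takes the left
trivialization to minus the right one and vice versa. A field tangent to the graph of `φ`, whose
first component reads `a` on the left and `b` on the right, thus reads `(a, -b)` and `(b, -a)` in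
the trivializations of `G × G`. Differentiating along the graph and averaging gives again a vector
of the form `(u, dφ u)` (`meanConnection_tangent_graph`), so the second fundamental form vanishes.
The same exchange shows that the induced metric is `2 h`, which is nondegenerate.

The graph is a smooth embedding because a shear of `G × G` carries a slice onto it. Its image is the
twisted conjugacy class by a computation in the group. For `SU(2)` the embedding is composed with a
diffeomorphism from the sphere. -/

/-! ### Derivatives between model spaces, and flat connections of trivialized tangent bundles -/

section Prelim

variable {E : Type*} [NormedAddCommGroup E] [NormedSpace ℝ E]
  {H : Type*} [TopologicalSpace H] {I : ModelWithCorners ℝ E H}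
  {M : Type*} [TopologicalSpace M] [ChartedSpace H M]
  {E' : Type*} [NormedAddCommGroup E'] [NormedSpace ℝ E']
  {H' : Type*} [TopologicalSpace H'] {J : ModelWithCorners ℝ E' H'}
  {N : Type*} [TopologicalSpace N] [ChartedSpace H' N]
  {E'' : Type*} [NormedAddCommGroup E''] [NormedSpace ℝ E'']
  {H'' : Type*} [TopologicalSpace H''] {K : ModelWithCorners ℝ E'' H''}
  {P : Type*} [TopologicalSpace P] [ChartedSpace H'' P]

variable (I J) in
/-- The derivative of a map of manifolds, as a linear map between the model vector spaces: all
tangent spaces are copies of the model space, and forgetting the base point makes it possible to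
rewrite it. -/
noncomputable def modelDeriv (f : M → N) (x : M) : E →L[ℝ] E' := mfderiv I J f x

theorem modelDeriv_comp {g : N → P} {f : M → N} (x : M) (hg : MDifferentiableAt J K g (f x))
    (hf : MDifferentiableAt I J f x) :
    modelDeriv I K (fun y ↦ g (f y)) x = (modelDeriv J K g (f x)).comp (modelDeriv I J f x) :=
  mfderiv_comp x hg hf

/-- The base point `y` is separate from `f x` because in a group the two often agree only after a
computation, as in `x⁻¹ * x = 1`. -/
theorem modelDeriv_comp_apply {g : N → P} {f : M → N} (hg : MDifferentiable J K g)
    (hf : MDifferentiable I J f) {x : M} {y : N} (hy : f x = y) (v : E) :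
    modelDeriv J K g y (modelDeriv I J f x v) = modelDeriv I K (fun y ↦ g (f y)) x v := by
  subst hy
  rw [modelDeriv_comp x (hg _) (hf _)]
  rfl

theorem modelDeriv_id (x : M) : modelDeriv I I (fun y : M ↦ y) x = ContinuousLinearMap.id ℝ E :=
  mfderiv_id

theorem modelDeriv_const (c : N) (x : M) : modelDeriv I J (fun _ : M ↦ c) x = 0 :=
  mfderiv_const

theorem modelDeriv_prodMk {F F' : Type*} [NormedAddCommGroup F] [NormedSpace ℝ F]
    [NormedAddCommGroup F'] [NormedSpace ℝ F'] {f : M → F} {g : M → F'} {x : M}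
    (hf : MDifferentiableAt I 𝓘(ℝ, F) f x) (hg : MDifferentiableAt I 𝓘(ℝ, F') g x) (v : E) :
    modelDeriv I 𝓘(ℝ, F × F') (fun y ↦ (f y, g y)) x v =
      (modelDeriv I 𝓘(ℝ, F) f x v, modelDeriv I 𝓘(ℝ, F') g x v) := by
  have h := hf.prodMk_space hg
  have h1 := modelDeriv_comp (K := 𝓘(ℝ, F)) (g := Prod.fst) x
    (differentiable_fst (𝕜 := ℝ)).differentiableAt.mdifferentiableAt h
  have h2 := modelDeriv_comp (K := 𝓘(ℝ, F')) (g := Prod.snd) x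
    (differentiable_snd (𝕜 := ℝ)).differentiableAt.mdifferentiableAt h
  rw [h1, h2]
  have e1 : modelDeriv 𝓘(ℝ, F × F') 𝓘(ℝ, F) Prod.fst (f x, g x) = .fst ℝ F F' :=
    mfderiv_eq_fderiv.trans fderiv_fst
  have e2 : modelDeriv 𝓘(ℝ, F × F') 𝓘(ℝ, F') Prod.snd (f x, g x) = .snd ℝ F F' :=
    mfderiv_eq_fderiv.trans fderiv_snd
  rw [e1, e2]
  rfl

theorem modelDeriv_diag {F : M × M → N} {x : M}
    (hF : MDifferentiableAt (I.prod I) J F (x, x)) (v : E) :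
    modelDeriv I J (fun y ↦ F (y, y)) x v =
      modelDeriv I J (fun a ↦ F (a, x)) x v + modelDeriv I J (fun b ↦ F (x, b)) x v := by
  have h1 : MDifferentiableAt I I (fun y : M ↦ y) x := mdifferentiableAt_id
  have h2 := modelDeriv_comp (K := J) (f := fun y ↦ (y, y)) (g := F) x hF (h1.prodMk h1)
  have h3 : modelDeriv I (I.prod I) (fun y : M ↦ (y, y)) x =
      (modelDeriv I I (fun y : M ↦ y) x).prod (modelDeriv I I (fun y : M ↦ y) x) :=
    mfderiv_prodMk h1 h1
  rw [h2, h3, modelDeriv_id]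
  exact mfderiv_prod_eq_add_apply (v := ((v, v) : E × E)) hF

theorem modelDeriv_clm {F F' : Type*} [NormedAddCommGroup F] [NormedSpace ℝ F]
    [NormedAddCommGroup F'] [NormedSpace ℝ F'] (C : F →L[ℝ] F') (x : F) :
    modelDeriv 𝓘(ℝ, F) 𝓘(ℝ, F') C x = C :=
  mfderiv_eq_fderiv.trans C.fderiv

/-- Differentiate `s ∘ s = id` at `y` and at `s y`. The inverse of the derivative is what enters the
pullback of vector fields. -/
theorem inverse_mfderiv_of_involutive {s : M → M} (hs : MDifferentiable I I s)
    (hss : ∀ y, s (s y) = y) (y : M) :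
    ContinuousLinearMap.IsInvertible (modelDeriv I I s y) ∧
      (modelDeriv I I s y).inverse = modelDeriv I I s (s y) := by
  have h1 : (modelDeriv I I s (s y)).comp (modelDeriv I I s y) = .id ℝ E := by
    rw [← modelDeriv_comp y (hs _) (hs _), funext hss]
    exact modelDeriv_id y
  have h2 : (modelDeriv I I s y).comp (modelDeriv I I s (s y)) = .id ℝ E := by
    have h := modelDeriv_comp (s y) (hs (s (s y))) (hs (s y))
    rw [funext hss, hss] at h
    exact h.symm.trans (modelDeriv_id _)
  exact ⟨.of_inverse h2 h1, ContinuousLinearMap.inverse_eq h2 h1⟩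

theorem PseudoRiemannianMetric.inner_congr [IsManifold I 1 M] (g : PseudoRiemannianMetric I M)
    {x y : M} (h : x = y) (v w : E) :
    g.inner x (v : TangentSpace I x) (w : TangentSpace I x) =
      g.inner y (v : TangentSpace I y) (w : TangentSpace I y) := by
  subst h
  rfl

/-- At its own base point the preferred trivialization is the identity of the model space. -/
theorem trivializationAt_tangentSpace_snd_of_eq [IsManifold I 1 M] {x y : M} (h : x = y) (v : E) :
    (trivializationAt E (TangentSpace I) x (⟨y, v⟩ : TangentBundle I M)).2 = v := by
  subst h
  rw [TangentBundle.trivializationAt_apply]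
  exact (tangentBundleCore I M).coordChange_self (achart H x) x (mem_chart_source H x) v

/-- If `F (y, y)` is constant then the partial derivative of `F` in the second variable at `(y, y)`
takes differentiable vector fields to differentiable functions. -/
theorem mdifferentiableAt_modelDeriv_diag [IsManifold I 1 M] [IsManifold J 1 N]
    {F : M × M → N} (hF : ContMDiff (I.prod I) J ∞ F) {c : N} (hc : ∀ y, F (y, y) = c)
    {Y : ∀ x : M, TangentSpace I x} {x : M} (hY : MDiffAt (T% Y) x) :
    MDifferentiableAt I 𝓘(ℝ, E') (fun y ↦ modelDeriv I J (fun b ↦ F (y, b)) y (Y y)) x := by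
  -- The partial derivative is the tangent map of `F` on the field `(0, Y y)` along the diagonal.
  -- All values lie over the single point `c`, so reading them in the trivialization there changes
  -- nothing.
  have h1 : MDifferentiableAt I (I.tangent.prod I.tangent)
      (fun y : M ↦ ((⟨y, 0⟩ : TangentBundle I M), (⟨y, Y y⟩ : TangentBundle I M))) x :=
    (mdifferentiableAt_zeroSection (𝕜 := ℝ) (F := E) (E := (TangentSpace I : M → Type _))).prodMk hY
  have h2 : ContMDiff (I.tangent.prod I.tangent) (I.prod I).tangent 1
      (equivTangentBundleProd I M I M).symm := contMDiff_equivTangentBundleProd_symm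
  have h3 : ContMDiff (I.prod I).tangent J.tangent 1 (tangentMap (I.prod I) J F) :=
    hF.contMDiff_tangentMap (by norm_cast)
  have h4 := ((h3.comp h2).mdifferentiable one_ne_zero _).comp x h1
  rw [mdifferentiableAt_totalSpace] at h4
  refine h4.2.congr_of_eventuallyEq (Eventually.of_forall fun y ↦ ?_)
  refine Eq.trans ?_ (trivializationAt_tangentSpace_snd_of_eq
    (show F (x, x) = F (y, y) by rw [hc, hc]) _).symm
  have hd := mfderiv_prod_eq_add_apply (v := ((0, Y y) : E × E))
    ((hF.mdifferentiable (by norm_num)) (y, y))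
  refine Eq.trans ?_ hd.symm
  exact ((zero_add _).symm.trans (congrArg (· + _) (map_zero _).symm))

/-- The flat connection of a trivialization `θ` of the tangent bundle, for which the fields `Y` with
`θ Y` constant are parallel. -/
noncomputable def flatConnection (I : ModelWithCorners ℝ E H) (θ : M → E ≃L[ℝ] E) (Y : M → E)
    (x : M) : E →L[ℝ] E :=
  ((θ x).symm : E →L[ℝ] E).comp (modelDeriv I 𝓘(ℝ, E) (fun y ↦ θ y (Y y)) x)

theorem flatConnection_apply (θ : M → E ≃L[ℝ] E) (Y : M → E) (x : M) (v : E) :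
    flatConnection I θ Y x v = (θ x).symm (modelDeriv I 𝓘(ℝ, E) (fun y ↦ θ y (Y y)) x v) := rfl

/-- `Y` is a vector field that is differentiable at `x`. -/
def MDiffFieldAt (I : ModelWithCorners ℝ E H) [IsManifold I 1 M] (Y : M → E) (x : M) : Prop :=
  MDifferentiableAt I I.tangent (fun y ↦ (⟨y, Y y⟩ : TangentBundle I M)) x

/-- A trivialization of the tangent bundle that takes differentiable vector fields to differentiable
functions. -/
def IsMDiffTrivialization (I : ModelWithCorners ℝ E H) [IsManifold I 1 M] (θ : M → E ≃L[ℝ] E) :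
    Prop :=
  ∀ (Y : M → E) (x : M), MDiffFieldAt I Y x → MDifferentiableAt I 𝓘(ℝ, E) (fun y ↦ θ y (Y y)) x

variable [IsManifold I 1 M] {θ θ' : M → E ≃L[ℝ] E}

theorem flatConnection_add (hθ : IsMDiffTrivialization I θ) {X Y : M → E} {x : M}
    (hX : MDiffFieldAt I X x) (hY : MDiffFieldAt I Y x) :
    flatConnection I θ (X + Y) x = flatConnection I θ X x + flatConnection I θ Y x := by
  have h : (fun y ↦ θ y ((X + Y) y)) = (fun y ↦ θ y (X y)) + fun y ↦ θ y (Y y) := by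
    funext y
    exact map_add (θ y) _ _
  have h1 : modelDeriv I 𝓘(ℝ, E) ((fun y ↦ θ y (X y)) + fun y ↦ θ y (Y y)) x =
      modelDeriv I 𝓘(ℝ, E) (fun y ↦ θ y (X y)) x + modelDeriv I 𝓘(ℝ, E) (fun y ↦ θ y (Y y)) x :=
    have h2 := mvfderiv_add (hθ X x hX) (hθ Y x hY)
    h2
  rw [flatConnection, h, h1, ContinuousLinearMap.comp_add]
  rfl

theorem flatConnection_smul (hθ : IsMDiffTrivialization I θ) {Y : M → E} {g : M → ℝ} {x : M}
    (hY : MDiffFieldAt I Y x) (hg : MDifferentiableAt I 𝓘(ℝ, ℝ) g x) :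
    flatConnection I θ (g • Y) x =
      g x • flatConnection I θ Y x + (modelDeriv I 𝓘(ℝ, ℝ) g x).smulRight (Y x) := by
  have h : (fun y ↦ θ y ((g • Y) y)) = g • fun y ↦ θ y (Y y) := by
    funext y
    exact map_smul (θ y) _ _
  have h1 : modelDeriv I 𝓘(ℝ, E) (g • fun y ↦ θ y (Y y)) x =
      g x • modelDeriv I 𝓘(ℝ, E) (fun y ↦ θ y (Y y)) x +
        (modelDeriv I 𝓘(ℝ, ℝ) g x).smulRight (θ x (Y x)) :=
    have h2 := mvfderiv_smul hg (hθ Y x hY)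
    h2
  ext v
  rw [flatConnection_apply, h, h1]
  simp [flatConnection_apply]

/-- A metric that becomes constant in a trivialization of the tangent bundle is parallel for the
corresponding flat connection. -/
theorem flatConnection_metric (hθ : IsMDiffTrivialization I θ) {g : M → E →L[ℝ] E →L[ℝ] ℝ}
    {b : E →L[ℝ] E →L[ℝ] ℝ} (hb : ∀ x v w, b (θ x v) (θ x w) = g x v w) {Y Z : M → E} {x : M}
    (hY : MDiffFieldAt I Y x) (hZ : MDiffFieldAt I Z x) (v : E) :
    modelDeriv I 𝓘(ℝ, ℝ) (fun y ↦ g y (Y y) (Z y)) x v =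
      g x (flatConnection I θ Y x v) (Z x) + g x (Y x) (flatConnection I θ Z x v) := by
  have hB := b.isBoundedBilinearMap
  have h1 := modelDeriv_comp (K := 𝓘(ℝ, ℝ)) (g := fun p : E × E ↦ b p.1 p.2) x
    (hB.differentiableAt (θ x (Y x), θ x (Z x))).mdifferentiableAt
    ((hθ Y x hY).prodMk_space (hθ Z x hZ))
  have h2 : modelDeriv 𝓘(ℝ, E × E) 𝓘(ℝ, ℝ) (fun p : E × E ↦ b p.1 p.2) (θ x (Y x), θ x (Z x)) =
      hB.deriv (θ x (Y x), θ x (Z x)) := mfderiv_eq_fderiv.trans (hB.hasFDerivAt _).fderiv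
  simp only [← hb]
  rw [h1, h2, ContinuousLinearMap.comp_apply, modelDeriv_prodMk (hθ Y x hY) (hθ Z x hZ),
    hB.deriv_apply, flatConnection_apply, flatConnection_apply,
    ContinuousLinearEquiv.apply_symm_apply, ContinuousLinearEquiv.apply_symm_apply, add_comm]

/-- If an involution `s` exchanges two trivializations of the tangent bundle up to a constant linear
map, then at a fixed point at which its derivative is `-1` it exchanges the two flat connections. -/
theorem flatConnection_involution (hθ' : IsMDiffTrivialization I θ')
    {s : M → M} (hs : MDifferentiable I I s) {x : M}
    (hsx : s x = x) (hd : ∀ v, modelDeriv I I s x v = -v) {C : E →L[ℝ] E}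
    (hC : ∀ (y : M) (v : E), θ y (modelDeriv I I s (s y) v) = C (θ' (s y) v))
    {Y : M → E} (hY : MDiffFieldAt I Y x) (v : E) :
    flatConnection I θ (fun y ↦ modelDeriv I I s (s y) (Y (s y))) x v =
      flatConnection I θ' Y x v := by
  have hY' := hθ' Y x hY
  have h1 := modelDeriv_comp (I := I) (J := I) (K := 𝓘(ℝ, E)) (f := s)
    (g := fun y ↦ C (θ' y (Y y))) x
    (by rw [hsx]; exact (C.mdifferentiableAt (x := θ' x (Y x))).comp x hY') (hs x)
  rw [hsx, modelDeriv_comp (g := C) x C.mdifferentiableAt hY', modelDeriv_clm] at h1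
  -- At the fixed point `hC` gives `C (θ' x w) = -θ x w`. This sign cancels the one from `ds v = -v`
  -- in the chain rule `h1`.
  have hx := hC x (-(θ' x).symm (modelDeriv I 𝓘(ℝ, E) (fun y ↦ θ' y (Y y)) x v))
  rw [hsx, hd, neg_neg, map_neg (θ' x), ContinuousLinearEquiv.apply_symm_apply] at hx
  rw [flatConnection_apply, flatConnection_apply, ContinuousLinearEquiv.symm_apply_eq, hx]
  simp only [hC]
  rw [h1, ContinuousLinearMap.comp_apply, ContinuousLinearMap.comp_apply, hd, map_neg]

end Prelim

/-! ### Algebra of the symmetry argument -/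

theorem geodesicSymmetry_involutive {G : Type*} [Group G] (x y : G) :
    x * (x * y⁻¹ * x)⁻¹ * x = y := by group

/-- A bilinear `T` is unchanged when both arguments change sign, while the right-hand side changes
sign. This is applied with `T` the torsion, `c` the Lie bracket, and `a`, `b` the covariant
derivatives of the two fields. -/
theorem eq_zero_of_odd {E : Type*} [NormedAddCommGroup E] [NormedSpace ℝ E]
    (T : E →L[ℝ] E →L[ℝ] E) (a b : E →L[ℝ] E) (u w c : E)
    (h1 : T u w = b u - a w - c) (h2 : T (-u) (-w) = b (-u) - a (-w) - -c) :
    b u - a w - c = 0 := by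
  simp only [map_neg, neg_apply, neg_neg] at h2
  have h : (2 : ℝ) • (b u - a w - c) = 0 := by
    rw [two_smul]
    nth_rw 1 [← h1, h2]
    module
  exact (smul_eq_zero.1 h).resolve_left two_ne_zero

/-! ### Left and right trivializations of a Lie group -/

section LieGroup

variable {E : Type*} [NormedAddCommGroup E] [NormedSpace ℝ E]
  {H : Type*} [TopologicalSpace H] {I : ModelWithCorners ℝ E H}
  {G : Type*} [TopologicalSpace G] [ChartedSpace H G] [Group G] [LieGroup I ∞ G]

theorem mdifferentiable_const_mul (a : G) : MDifferentiable I I fun k : G ↦ a * k :=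
  (contMDiff_mul_left (n := ∞)).mdifferentiable (by norm_num)

theorem mdifferentiable_mul_const (a : G) : MDifferentiable I I fun k : G ↦ k * a :=
  (contMDiff_mul_right (n := ∞)).mdifferentiable (by norm_num)

theorem mdifferentiable_group_inv : MDifferentiable I I fun k : G ↦ k⁻¹ :=
  (contMDiff_inv I ∞).mdifferentiable (by norm_num)

theorem contMDiff_mul_inv_mul (a b : G) : ContMDiff I I ∞ fun k : G ↦ a * k⁻¹ * b :=
  (contMDiff_mul_right (a := b)).comp ((contMDiff_mul_left (a := a)).comp (contMDiff_inv I ∞))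

theorem mdifferentiable_mul_inv_mul (a b : G) : MDifferentiable I I fun k : G ↦ a * k⁻¹ * b :=
  (contMDiff_mul_inv_mul a b).mdifferentiable (by norm_num)

/-- Differentiate `k * k⁻¹ = 1` at the identity, as the sum of two partial derivatives. -/
theorem modelDeriv_inv_one (v : E) : modelDeriv I I (fun k : G ↦ k⁻¹) 1 v = -v := by
  have hF : ContMDiff (I.prod I) I ∞ fun p : G × G ↦ p.1 * p.2⁻¹ :=
    contMDiff_fst.mul contMDiff_snd.inv
  have h := modelDeriv_diag (hF.mdifferentiable (by norm_num) (1, 1)) v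
  simp only [mul_inv_cancel, inv_one, mul_one, one_mul, modelDeriv_const, modelDeriv_id] at h
  exact (neg_eq_of_add_eq_zero_right h.symm).symm

variable (I) in
/-- The trivialization of the tangent bundle of a Lie group by left translations. -/
noncomputable def leftTriv (x : G) : E ≃L[ℝ] E :=
  .equivOfInverse' (modelDeriv I I (fun k ↦ x⁻¹ * k) x) (modelDeriv I I (fun k ↦ x * k) 1)
    (by
      ext v
      refine (modelDeriv_comp_apply (mdifferentiable_const_mul _) (mdifferentiable_const_mul _)
        (mul_one x) v).trans ?_
      simp [modelDeriv_id])
    (by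
      ext v
      refine (modelDeriv_comp_apply (mdifferentiable_const_mul _) (mdifferentiable_const_mul _)
        (inv_mul_cancel x) v).trans ?_
      simp [modelDeriv_id])

variable (I) in
/-- The trivialization of the tangent bundle of a Lie group by right translations. -/
noncomputable def rightTriv (x : G) : E ≃L[ℝ] E :=
  .equivOfInverse' (modelDeriv I I (fun k ↦ k * x⁻¹) x) (modelDeriv I I (fun k ↦ k * x) 1)
    (by
      ext v
      refine (modelDeriv_comp_apply (mdifferentiable_mul_const _) (mdifferentiable_mul_const _)
        (one_mul x) v).trans ?_
      simp [modelDeriv_id])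
    (by
      ext v
      refine (modelDeriv_comp_apply (mdifferentiable_mul_const _) (mdifferentiable_mul_const _)
        (mul_inv_cancel x) v).trans ?_
      simp [modelDeriv_id])

theorem leftTriv_apply (x : G) (v : E) :
    leftTriv I x v = modelDeriv I I (fun k ↦ x⁻¹ * k) x v := rfl

theorem rightTriv_apply (x : G) (v : E) :
    rightTriv I x v = modelDeriv I I (fun k ↦ k * x⁻¹) x v := rfl

/-- The trivialization at `y` is the partial derivative in the second variable of `(y, k) ↦ y⁻¹ *
k`, which is constant on the diagonal. -/
theorem isMDiffTrivialization_leftTriv :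
    IsMDiffTrivialization I (leftTriv I : G → E ≃L[ℝ] E) := fun _ _ hY ↦
  mdifferentiableAt_modelDeriv_diag (F := fun p : G × G ↦ p.1⁻¹ * p.2) (c := 1)
    (contMDiff_fst.inv.mul contMDiff_snd) (fun _ ↦ inv_mul_cancel _) hY

theorem isMDiffTrivialization_rightTriv :
    IsMDiffTrivialization I (rightTriv I : G → E ≃L[ℝ] E) := fun _ _ hY ↦
  mdifferentiableAt_modelDeriv_diag (F := fun p : G × G ↦ p.2 * p.1⁻¹) (c := 1)
    (contMDiff_snd.mul contMDiff_fst.inv) (fun _ ↦ mul_inv_cancel _) hY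

/-- The derivative of `k ↦ k⁻¹ z` takes the left to minus the right trivialization. -/
theorem rightTriv_modelDeriv_inv_mul (z x : G) (v : E) :
    rightTriv I (x⁻¹ * z) (modelDeriv I I (fun k ↦ k⁻¹ * z) x v) = -leftTriv I x v := by
  have h := mdifferentiable_mul_inv_mul (I := I) 1 z
  simp only [one_mul] at h
  rw [rightTriv_apply, modelDeriv_comp_apply (mdifferentiable_mul_const _) h rfl,
    ← modelDeriv_inv_one (I := I) (G := G), leftTriv_apply,
    modelDeriv_comp_apply mdifferentiable_group_inv (mdifferentiable_const_mul _)
      (inv_mul_cancel x)]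
  simp [mul_assoc]

/-- The derivative of `k ↦ k⁻¹ z`, for central `z`, takes the right to minus the left
trivialization. -/
theorem leftTriv_modelDeriv_inv_mul {z : G} (hz : z ∈ Subgroup.center G) (x : G) (v : E) :
    leftTriv I (x⁻¹ * z) (modelDeriv I I (fun k ↦ k⁻¹ * z) x v) = -rightTriv I x v := by
  have h := mdifferentiable_mul_inv_mul (I := I) 1 z
  simp only [one_mul] at h
  have hfun : (fun k : G ↦ (x⁻¹ * z)⁻¹ * (k⁻¹ * z)) = fun k ↦ (k * x⁻¹)⁻¹ := by
    funext k
    rw [← mul_assoc, Subgroup.mem_center_iff.1 hz]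
    group
  rw [leftTriv_apply, modelDeriv_comp_apply (mdifferentiable_const_mul _) h rfl,
    ← modelDeriv_inv_one (I := I) (G := G), rightTriv_apply,
    modelDeriv_comp_apply mdifferentiable_group_inv (mdifferentiable_mul_const _)
      (mul_inv_cancel x), hfun]

/-! ### The geodesic symmetry at a point -/

section GeodesicSymmetry

variable (x : G)

/-- A left translation by `x⁻¹` turns the symmetry into inversion at the identity: `x⁻¹ * (x * k⁻¹ *
x) = (x⁻¹ * k)⁻¹`. -/
theorem modelDeriv_geodesicSymmetry (v : E) :
    modelDeriv I I (fun k ↦ x * k⁻¹ * x) x v = -v := by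
  have h : (fun k ↦ x⁻¹ * (x * k⁻¹ * x)) = fun k ↦ (x⁻¹ * k)⁻¹ := by
    funext k
    group
  apply (leftTriv I x).injective
  rw [map_neg, leftTriv_apply, leftTriv_apply, modelDeriv_comp_apply (mdifferentiable_const_mul _)
    (mdifferentiable_mul_inv_mul x x) (by group), h, ← modelDeriv_inv_one (I := I) (G := G),
    modelDeriv_comp_apply mdifferentiable_group_inv (mdifferentiable_const_mul _)
      (inv_mul_cancel x)]

/-- Put `m = k * (x * y⁻¹ * x)⁻¹`. Then `y⁻¹ * (x * k⁻¹ * x) = x⁻¹ * m⁻¹ * x`, a map of `m` that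
does not depend on `y`. Its derivative is the constant linear map required by
`flatConnection_involution`. -/
theorem leftTriv_modelDeriv_geodesicSymmetry (y : G) (v : E) :
    leftTriv I y (modelDeriv I I (fun k ↦ x * k⁻¹ * x) (x * y⁻¹ * x) v) =
      modelDeriv I I (fun k ↦ x⁻¹ * k⁻¹ * x) 1 (rightTriv I (x * y⁻¹ * x) v) := by
  rw [leftTriv_apply, rightTriv_apply, modelDeriv_comp_apply (mdifferentiable_const_mul _)
    (mdifferentiable_mul_inv_mul x x) (by group), modelDeriv_comp_apply
    (mdifferentiable_mul_inv_mul _ _) (mdifferentiable_mul_const _) (by group)]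
  congr 2
  funext k
  group

theorem rightTriv_modelDeriv_geodesicSymmetry (y : G) (v : E) :
    rightTriv I y (modelDeriv I I (fun k ↦ x * k⁻¹ * x) (x * y⁻¹ * x) v) =
      modelDeriv I I (fun k ↦ x * k⁻¹ * x⁻¹) 1 (leftTriv I (x * y⁻¹ * x) v) := by
  rw [leftTriv_apply, rightTriv_apply, modelDeriv_comp_apply (mdifferentiable_mul_const _)
    (mdifferentiable_mul_inv_mul x x) (by group), modelDeriv_comp_apply
    (mdifferentiable_mul_inv_mul _ _) (mdifferentiable_const_mul _) (by group)]
  congr 2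
  funext k
  group

end GeodesicSymmetry

/-! ### The mean connection and its identification with the Levi-Civita connection -/

variable (I) in
/-- The mean of the two flat connections given by left and by right translations. -/
noncomputable def meanConnection (Y : G → E) (x : G) : E →L[ℝ] E :=
  (1 / 2 : ℝ) • (flatConnection I (leftTriv I) Y x + flatConnection I (rightTriv I) Y x)

theorem meanConnection_apply (Y : G → E) (x : G) (v : E) :
    meanConnection I Y x v = (1 / 2 : ℝ) •
      (flatConnection I (leftTriv I) Y x v + flatConnection I (rightTriv I) Y x v) := rfl

theorem meanConnection_geodesicSymmetry {Y : G → E} {x : G} (hY : MDiffFieldAt I Y x) (v : E) :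
    meanConnection I (fun y ↦ modelDeriv I I (fun k ↦ x * k⁻¹ * x) (x * y⁻¹ * x)
      (Y (x * y⁻¹ * x))) x v = meanConnection I Y x v := by
  have h1 := flatConnection_involution (θ := leftTriv I) isMDiffTrivialization_rightTriv
    (mdifferentiable_mul_inv_mul x x)
    (by group) (modelDeriv_geodesicSymmetry x) (leftTriv_modelDeriv_geodesicSymmetry x) hY v
  have h2 := flatConnection_involution (θ := rightTriv I) isMDiffTrivialization_leftTriv
    (mdifferentiable_mul_inv_mul x x)
    (by group) (modelDeriv_geodesicSymmetry x) (rightTriv_modelDeriv_geodesicSymmetry x) hY v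
  rw [meanConnection_apply, meanConnection_apply, h1, h2, add_comm]

theorem meanConnection_add {X Y : G → E} {x : G} (hX : MDiffFieldAt I X x)
    (hY : MDiffFieldAt I Y x) :
    meanConnection I (X + Y) x = meanConnection I X x + meanConnection I Y x := by
  rw [meanConnection, flatConnection_add isMDiffTrivialization_leftTriv hX hY,
    flatConnection_add isMDiffTrivialization_rightTriv hX hY, meanConnection, meanConnection]
  module

theorem meanConnection_smul {Y : G → E} {g : G → ℝ} {x : G} (hY : MDiffFieldAt I Y x)
    (hg : MDifferentiableAt I 𝓘(ℝ, ℝ) g x) :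
    meanConnection I (g • Y) x =
      g x • meanConnection I Y x + (modelDeriv I 𝓘(ℝ, ℝ) g x).smulRight (Y x) := by
  rw [meanConnection, flatConnection_smul isMDiffTrivialization_leftTriv hY hg,
    flatConnection_smul isMDiffTrivialization_rightTriv hY hg, meanConnection]
  module

theorem isCovariantDerivativeOn_meanConnection :
    IsCovariantDerivativeOn (I := I) (V := fun x : G ↦ TangentSpace I x) E
      (meanConnection I) Set.univ where
  add hX hY _ := meanConnection_add hX hY
  leibniz hY hg _ := meanConnection_smul hY hg

variable (I G) in
/-- The mean of the two flat connections given by left and by right translations, as a covariant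
derivative on the tangent bundle. -/
noncomputable def meanCovariantDerivative :
    CovariantDerivative I E (fun x : G ↦ TangentSpace I x) where
  toFun := meanConnection I
  isCovariantDerivativeOnUniv := isCovariantDerivativeOn_meanConnection

/-- The torsion at `x` is computed on `X`, `Y` and on their pullbacks by the geodesic symmetry `s`.
Pulling back leaves the covariant derivatives at `x` unchanged, commutes with the bracket, and
negates the values at `x`, so the torsion is both even and odd. -/
theorem meanCovariantDerivative_torsionFree [FiniteDimensional ℝ E] (x : G)
    (X Y : ∀ x : G, TangentSpace I x) (hX : MDiffAt (T% X) x) (hY : MDiffAt (T% Y) x) :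
    meanCovariantDerivative I G Y x (X x) - meanCovariantDerivative I G X x (Y x) =
      VectorField.mlieBracket I X Y x := by
  have : CompleteSpace E := FiniteDimensional.complete ℝ E
  have : IsManifold I 2 G := .of_le (n := ∞) (by norm_cast)
  have : IsManifold I (minSmoothness ℝ 2) G := by simpa
  set D := meanCovariantDerivative I G
  set s : G → G := fun k ↦ x * k⁻¹ * x
  have hsx : s x = x := by simp [s]
  -- The pullback uses the inverse of `ds` at `y`, which for an involution is `ds` at `s y`.
  have hpull (Z : ∀ x : G, TangentSpace I x) : VectorField.mpullback I I s Z =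
      fun y ↦ modelDeriv I I s (s y) (Z (s y)) := by
    funext y
    exact congrArg (fun L : E →L[ℝ] E ↦ L (Z (s y)))
      (inverse_mfderiv_of_involutive (I := I) (E := E)
      (mdifferentiable_mul_inv_mul x x) (geodesicSymmetry_involutive x) y).2
  have hval (Z : G → E) : modelDeriv I I s (s x) (Z (s x)) = -Z x := by
    rw [hsx]
    exact modelDeriv_geodesicSymmetry x _
  have hdiff (Z : ∀ x : G, TangentSpace I x) (hZ : MDiffAt (T% Z) x) :
      MDiffAt (T% (VectorField.mpullback I I s Z)) x :=
    MDifferentiableAt.mpullback_vectorField (n := ∞) (by rwa [hsx])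
      (contMDiff_mul_inv_mul x x x) (inverse_mfderiv_of_involutive (I := I) (E := E)
        (mdifferentiable_mul_inv_mul x x) (geodesicSymmetry_involutive x) x).1
      (by norm_cast)
  have hD (Z : G → E) (hZ : MDiffFieldAt I Z x) (v : E) :
      meanConnection I (fun y ↦ modelDeriv I I s (s y) (Z (s y))) x v =
        meanConnection I Z x v := meanConnection_geodesicSymmetry hZ v
  have hbr := VectorField.mpullback_mlieBracket (n := ∞) (f := s) (x₀ := x) (V := X) (W := Y)
    (by rwa [hsx]) (by rwa [hsx]) (contMDiff_mul_inv_mul x x x) (by simp; norm_cast)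
  have t1 := D.torsion_apply hX hY
  have t2 := D.torsion_apply (hdiff X hX) (hdiff Y hY)
  rw [← hbr] at t2
  simp only [hpull] at t2
  -- From here on everything is typed in the model space `E`, so that `s x = x` can be rewritten
  -- without transport between tangent spaces.
  let T : E →L[ℝ] E →L[ℝ] E := D.torsion x
  let B : E := VectorField.mlieBracket I X Y x
  have e1 : T (X x) (Y x) = meanConnection I Y x (X x) - meanConnection I X x (Y x) - B := t1
  have e2 : T (modelDeriv I I s (s x) (X (s x))) (modelDeriv I I s (s x) (Y (s x))) =
      meanConnection I (fun y ↦ modelDeriv I I s (s y) (Y (s y))) x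
        (modelDeriv I I s (s x) (X (s x))) -
      meanConnection I (fun y ↦ modelDeriv I I s (s y) (X (s y))) x
        (modelDeriv I I s (s x) (Y (s x))) -
      modelDeriv I I s (s x) (VectorField.mlieBracket I X Y (s x)) := t2
  have e3 : modelDeriv I I s (s x) (VectorField.mlieBracket I X Y (s x)) = -B :=
    hval (VectorField.mlieBracket I X Y)
  rw [hD Y hY, hD X hX, e3, hval X, hval Y] at e2
  exact sub_eq_zero.1 (eq_zero_of_odd T _ _ _ _ B e1 e2)

/-- In the trivializations by left and by right translations, a bi-invariant metric is constant. -/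
theorem IsBiInvariant.inner_leftTriv {g : PseudoRiemannianMetric I G} (hg : IsBiInvariant g)
    (x : G) (v w : E) : g.inner (1 : G) (leftTriv I x v : E) (leftTriv I x w : E) =
      g.inner x (v : E) (w : E) := by
  have h := congrArg (fun b : E →L[ℝ] E →L[ℝ] ℝ ↦ b v w) (congrFun (hg.left x⁻¹) x)
  exact (g.inner_congr (inv_mul_cancel x) _ _).symm.trans h

theorem IsBiInvariant.inner_rightTriv {g : PseudoRiemannianMetric I G} (hg : IsBiInvariant g)
    (x : G) (v w : E) : g.inner (1 : G) (rightTriv I x v : E) (rightTriv I x w : E) =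
      g.inner x (v : E) (w : E) := by
  have h := congrArg (fun b : E →L[ℝ] E →L[ℝ] ℝ ↦ b v w) (congrFun (hg.right x⁻¹) x)
  exact (g.inner_congr (mul_inv_cancel x) _ _).symm.trans h

/-- The mean of the two flat connections is the Levi-Civita connection of every bi-invariant
metric. -/
theorem IsBiInvariant.isLeviCivita [FiniteDimensional ℝ E] {g : PseudoRiemannianMetric I G}
    (hg : IsBiInvariant g) : IsLeviCivita g (meanCovariantDerivative I G) where
  torsionFree := meanCovariantDerivative_torsionFree
  metric x v Y Z hY hZ := by
    let b : G → E →L[ℝ] E →L[ℝ] ℝ := g.inner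
    have h1 := flatConnection_metric (g := b) isMDiffTrivialization_leftTriv
      hg.inner_leftTriv hY hZ v
    have h2 := flatConnection_metric (g := b) isMDiffTrivialization_rightTriv
      hg.inner_rightTriv hY hZ v
    have h (β : E →L[ℝ] E →L[ℝ] ℝ) (p q p' q' y z : E) : β ((1 / 2 : ℝ) • (p + q)) z +
        β y ((1 / 2 : ℝ) • (p' + q')) = ((β p z + β y p') + (β q z + β y q')) / 2 := by
      simp only [map_smul, map_add, smul_apply, add_apply, smul_eq_mul]
      ring
    refine Eq.trans ?_ (h (b x) _ _ _ _ (Y x) (Z x)).symm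
    exact (add_self_div_two _).symm.trans (congrArg (· / 2) (congrArg₂ (· + ·) h1 h2))

end LieGroup

/-! ### Immersions, diffeomorphisms and the embedding of the graph -/

section Immersion

variable {E : Type*} [NormedAddCommGroup E] [NormedSpace ℝ E]
  {H : Type*} [TopologicalSpace H] {I : ModelWithCorners ℝ E H}
  {M : Type*} [TopologicalSpace M] [ChartedSpace H M]
  {M' : Type*} [TopologicalSpace M'] [ChartedSpace H M']
  {E' : Type*} [NormedAddCommGroup E'] [NormedSpace ℝ E']
  {H' : Type*} [TopologicalSpace H'] {J : ModelWithCorners ℝ E' H'}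
  {N : Type*} [TopologicalSpace N] [ChartedSpace H' N]
  {N' : Type*} [TopologicalSpace N'] [ChartedSpace H' N']
  {F : Type*} [NormedAddCommGroup F] [NormedSpace ℝ F] {n : WithTop ℕ∞}

theorem Diffeomorph.transOpenPartialHomeomorph_mem_maximalAtlas [IsManifold I n M]
    [IsManifold I n M'] (φ : Diffeomorph I I M' M n) {e : OpenPartialHomeomorph M H}
    (he : e ∈ IsManifold.maximalAtlas I n M) :
    φ.toHomeomorph.transOpenPartialHomeomorph e ∈ IsManifold.maximalAtlas I n M' := by
  apply OpenPartialHomeomorph.mem_maximalAtlas_of_contMDiffOn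
  · exact (contMDiffOn_of_mem_maximalAtlas he).comp φ.contMDiff.contMDiffOn
      fun x hx ↦ by simpa using hx
  · exact φ.symm.contMDiff.comp_contMDiffOn (contMDiffOn_symm_of_mem_maximalAtlas he)

open Manifold in
-- The domain chart is composed with `φ`; the local expression of the map is then unchanged.
theorem Manifold.IsImmersionAtOfComplement.comp_diffeomorph [IsManifold I n M] [IsManifold I n M']
    {f : M → N} (φ : Diffeomorph I I M' M n) {x : M'}
    (h : IsImmersionAtOfComplement F I J n f (φ x)) :
    IsImmersionAtOfComplement F I J n (f ∘ φ) x := by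
  refine .mk_of_charts h.equiv (φ.toHomeomorph.transOpenPartialHomeomorph h.domChart) h.codChart
    (by simpa using h.mem_domChart_source) h.mem_codChart_source
    (φ.transOpenPartialHomeomorph_mem_maximalAtlas h.domChart_mem_maximalAtlas)
    h.codChart_mem_maximalAtlas (fun y hy ↦ h.source_subset_preimage_source hy) ?_
  intro y hy
  have hy' : y ∈ (h.domChart.extend I).target := by simpa using hy
  simpa using h.writtenInCharts hy'

open Manifold in
theorem Manifold.IsImmersionAtOfComplement.diffeomorph_comp [IsManifold J n N] [IsManifold J n N']
    {f : M → N} (φ : Diffeomorph J J N N' n) {x : M}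
    (h : IsImmersionAtOfComplement F I J n f x) :
    IsImmersionAtOfComplement F I J n (φ ∘ f) x := by
  refine .mk_of_charts h.equiv h.domChart (φ.symm.toHomeomorph.transOpenPartialHomeomorph h.codChart)
    h.mem_domChart_source (by simpa using h.mem_codChart_source) h.domChart_mem_maximalAtlas
    (φ.symm.transOpenPartialHomeomorph_mem_maximalAtlas h.codChart_mem_maximalAtlas)
    (fun y hy ↦ by simpa using h.source_subset_preimage_source hy) ?_
  intro y hy
  simpa using h.writtenInCharts hy

open Manifold in
/-- The inclusion of a slice into a product is an immersion. -/
theorem Manifold.isImmersionAtOfComplement_slice {G : Type*} [TopologicalSpace G]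
    [ChartedSpace E' G] [IsManifold 𝓘(ℝ, E') n G] [IsManifold I n M] (c : G) (x : M) :
    IsImmersionAtOfComplement E' I (I.prod 𝓘(ℝ, E')) n (fun y : M ↦ (y, c)) x := by
  -- The chart is shifted to send `c` to `0`, since the normal form of an immersion is `u ↦ (u, 0)`.
  let τ := (chartAt E' c).trans
    (Homeomorph.addRight (-chartAt E' c c)).toOpenPartialHomeomorph
  have hτ : τ ∈ IsManifold.maximalAtlas 𝓘(ℝ, E') n G := by
    apply OpenPartialHomeomorph.mem_maximalAtlas_of_contMDiffOn
    · have h : ContDiff ℝ n fun v : E' ↦ v + -chartAt E' c c := by fun_prop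
      exact h.contMDiff.comp_contMDiffOn ((contMDiffOn_chart (x := c)).mono (by simp [τ]))
    · have h : ContDiff ℝ n fun v : E' ↦ v + - -chartAt E' c c := by fun_prop
      refine (contMDiffOn_chart_symm (x := c)).comp h.contMDiff.contMDiffOn fun v hv ↦ ?_
      simpa [τ] using hv
  have hprod : (chartAt H x).prod τ ∈ IsManifold.maximalAtlas (I.prod 𝓘(ℝ, E')) n (M × G) :=
    IsManifold.mem_maximalAtlas_prod (IsManifold.chart_mem_maximalAtlas x) hτ
  refine .mk_of_continuousAt (by fun_prop) (.refl ℝ _) (chartAt H x) ((chartAt H x).prod τ)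
    (mem_chart_source H x) ?_ (IsManifold.chart_mem_maximalAtlas x) hprod ?_
  · simp [τ]
  · intro y hy
    have hy' := hy
    rw [OpenPartialHomeomorph.extend_target] at hy'
    simp [τ, (chartAt H x).right_inv hy'.1, I.right_inv hy'.2]

theorem Manifold.IsSmoothEmbedding.comp_diffeomorph [IsManifold I n M] [IsManifold I n M']
    {f : M → N} (h : Manifold.IsSmoothEmbedding I J n f) (φ : Diffeomorph I I M' M n) :
    Manifold.IsSmoothEmbedding I J n (f ∘ φ) where
  isImmersion := by
    obtain ⟨F, _, _, hF⟩ := h.isImmersion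
    exact ⟨F, _, _, fun x ↦ (hF (φ x)).comp_diffeomorph φ⟩
  isEmbedding := h.isEmbedding.comp φ.toHomeomorph.isEmbedding

variable {G : Type*} [TopologicalSpace G] [ChartedSpace E G] [Group G] [LieGroup 𝓘(ℝ, E) ∞ G]

variable (E G) in
/-- The diffeomorphism `(x, y) ↦ (x, x⁻¹ y)` of `G × G`. -/
def shearDiffeomorph :
    Diffeomorph (𝓘(ℝ, E).prod 𝓘(ℝ, E)) (𝓘(ℝ, E).prod 𝓘(ℝ, E)) (G × G) (G × G) ∞ where
  toFun p := (p.1, p.1⁻¹ * p.2)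
  invFun p := (p.1, p.1 * p.2)
  left_inv p := by simp
  right_inv p := by simp
  contMDiff_toFun := contMDiff_fst.prodMk (contMDiff_fst.inv.mul contMDiff_snd)
  contMDiff_invFun := contMDiff_fst.prodMk (contMDiff_fst.mul contMDiff_snd)

/-- The map is the slice `x ↦ (x, z)` followed by the shear, and the first projection is a
continuous left inverse. -/
theorem isSmoothEmbedding_inv_mul (z : G) :
    Manifold.IsSmoothEmbedding 𝓘(ℝ, E) (𝓘(ℝ, E).prod 𝓘(ℝ, E)) ∞ fun x : G ↦ (x, x⁻¹ * z) where
  isImmersion := Manifold.IsImmersionOfComplement.isImmersion fun x ↦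
    (Manifold.isImmersionAtOfComplement_slice (E' := E) z x).diffeomorph_comp
      (shearDiffeomorph E G)
  isEmbedding := by
    have h1 : ContMDiff 𝓘(ℝ, E) 𝓘(ℝ, E) ∞ fun x : G ↦ x⁻¹ * z :=
      (contMDiff_inv 𝓘(ℝ, E) ∞).mul contMDiff_const
    exact .of_leftInverse (f := Prod.fst) (fun _ ↦ rfl) continuous_fst
      (continuous_id.prodMk h1.continuous)

end Immersion

/-! ### The twisted conjugacy class as a set -/

section TwistedConjugacy

variable {G : Type*} [Group G] {z : G}

theorem twistedConjClass_one_eq_preimage (hz : z ∈ Subgroup.center G) :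
    twistedConjClass ((1, z) : G × G) = (fun p : G × G ↦ p.1 * p.2) ⁻¹' {z} := by
  rw [Subgroup.mem_center_iff] at hz
  ext ⟨x, y⟩
  simp only [twistedConjClass, Set.mem_range, Set.mem_preimage, Set.mem_singleton_iff]
  constructor
  · rintro ⟨u, hu⟩
    simp only [twistedAd, Prod.mk.injEq] at hu
    rw [← hu.1, ← hu.2, mul_one, mul_assoc, mul_assoc u.2, inv_mul_cancel_left, ← mul_assoc,
      hz, mul_inv_cancel_right]
  · rintro rfl
    -- Acting by `(x, 1)` on `(1, x * y)` gives `(x, x * y * x⁻¹)`, whose second entry is `y`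
    -- because `x * y` is central.
    refine ⟨(x, 1), ?_⟩
    have := hz x
    simp only [twistedAd, Prod.mk.injEq]
    refine ⟨by simp, ?_⟩
    rw [one_mul, ← hz]
    group

theorem range_inv_mul_eq_preimage (z : G) :
    Set.range (fun x : G ↦ (x, x⁻¹ * z)) = (fun p : G × G ↦ p.1 * p.2) ⁻¹' {z} := by
  ext ⟨x, y⟩
  simp only [Set.mem_range, Prod.mk.injEq, Set.mem_preimage, Set.mem_singleton_iff]
  constructor
  · rintro ⟨w, rfl, rfl⟩
    simp
  · rintro rfl
    exact ⟨x, rfl, by simp⟩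

theorem range_inv_mul_eq_image_mul_right (z : G) :
    Set.range (fun x : G ↦ (x, x⁻¹ * z)) = (fun p ↦ p * (1, z)) '' antiDiagonal G := by
  rw [antiDiagonal, ← Set.range_comp]
  simp [Function.comp_def]

theorem range_inv_mul_eq_image_mul_left (hz : z ∈ Subgroup.center G) :
    Set.range (fun x : G ↦ (x, x⁻¹ * z)) = (fun p ↦ (1, z) * p) '' antiDiagonal G := by
  rw [antiDiagonal, ← Set.range_comp]
  simp [Function.comp_def, Subgroup.mem_center_iff.1 hz]

end TwistedConjugacy

/-! ### The product group and the graph of `x ↦ x⁻¹ * z` -/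

section Product

variable {E : Type*} [NormedAddCommGroup E] [NormedSpace ℝ E]
  {H : Type*} [TopologicalSpace H] {I : ModelWithCorners ℝ E H}
  {M : Type*} [TopologicalSpace M] [ChartedSpace H M]
  {E' : Type*} [NormedAddCommGroup E'] [NormedSpace ℝ E']
  {H' : Type*} [TopologicalSpace H'] {J : ModelWithCorners ℝ E' H'}
  {N : Type*} [TopologicalSpace N] [ChartedSpace H' N]

theorem modelDeriv_prodMap {f : M → M} {g : N → N} (hf : MDifferentiable I I f)
    (hg : MDifferentiable J J g) (p : M × N) (v : E × E') :
    modelDeriv (I.prod J) (I.prod J) (Prod.map f g) p v =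
      (modelDeriv I I f p.1 v.1, modelDeriv J J g p.2 v.2) :=
  congrArg (fun L : E × E' →L[ℝ] E × E' ↦ L v) (mfderiv_prodMap (hf p.1) (hg p.2))

theorem modelDeriv_graph {f : M → N} (hf : MDifferentiable I J f) (x : M) (v : E) :
    modelDeriv I (I.prod J) (fun y ↦ (y, f y)) x v = (v, modelDeriv I J f x v) :=
  congrArg (fun L : E →L[ℝ] E × E' ↦ L v)
    ((mfderiv_prodMk mdifferentiableAt_id (hf x)).trans
      (congrArg (fun L : E →L[ℝ] E ↦ L.prod (modelDeriv I J f x)) mfderiv_id))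

theorem modelDeriv_congr {f g : M → N} {x : M} (h : f =ᶠ[𝓝 x] g) :
    modelDeriv I J f x = modelDeriv I J g x := h.mfderiv_eq

theorem PseudoRiemannianMetric.prod_inner_apply [IsManifold I 1 M] [IsManifold J 1 N]
    (g : PseudoRiemannianMetric I M) (h : PseudoRiemannianMetric J N) (p : M × N)
    (v w : E × E') : (g.prod h).inner p v w =
      g.inner p.1 (v.1 : E) (w.1 : E) + h.inner p.2 (v.2 : E') (w.2 : E') := by
  change g.inner p.1 (mfderiv (I.prod J) I Prod.fst p v) (mfderiv (I.prod J) I Prod.fst p w) +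
    h.inner p.2 (mfderiv (I.prod J) J Prod.snd p v) (mfderiv (I.prod J) J Prod.snd p w) = _
  rw [mfderiv_fst, mfderiv_snd]
  rfl

theorem PseudoRiemannianMetric.prod_inner_prodMap [IsManifold I 1 M] [IsManifold J 1 N]
    (g : PseudoRiemannianMetric I M) (h : PseudoRiemannianMetric J N) {f : M → M} {k : N → N}
    (hf : MDifferentiable I I f) (hk : MDifferentiable J J k)
    (hgf : ∀ (q : M) (v w : E),
      g.inner (f q) (modelDeriv I I f q v : E) (modelDeriv I I f q w : E) = g.inner q v w)
    (hhk : ∀ (q : N) (v w : E'),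
      h.inner (k q) (modelDeriv J J k q v : E') (modelDeriv J J k q w : E') = h.inner q v w)
    (p : M × N) (v w : E × E') :
    (g.prod h).inner (Prod.map f k p)
      (modelDeriv (I.prod J) (I.prod J) (Prod.map f k) p v : E × E')
      (modelDeriv (I.prod J) (I.prod J) (Prod.map f k) p w : E × E') = (g.prod h).inner p v w := by
  refine ((g.prod_inner_apply h _ _ _).trans ?_).trans (g.prod_inner_apply h _ _ _).symm
  rw [modelDeriv_prodMap hf hk, modelDeriv_prodMap hf hk]
  exact congrArg₂ (· + ·) (hgf _ _ _) (hhk _ _ _)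

variable {G : Type*} [TopologicalSpace G] [ChartedSpace H G] [Group G] [LieGroup I ∞ G]

theorem leftTriv_prod (p : G × G) (v : E × E) :
    leftTriv (I.prod I) p v = (leftTriv I p.1 v.1, leftTriv I p.2 v.2) :=
  modelDeriv_prodMap (mdifferentiable_const_mul p.1⁻¹) (mdifferentiable_const_mul p.2⁻¹) p v

theorem rightTriv_prod (p : G × G) (v : E × E) :
    rightTriv (I.prod I) p v = (rightTriv I p.1 v.1, rightTriv I p.2 v.2) :=
  modelDeriv_prodMap (mdifferentiable_mul_const p.1⁻¹) (mdifferentiable_mul_const p.2⁻¹) p v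

theorem leftTriv_prod_symm (p : G × G) (v : E × E) :
    (leftTriv (I.prod I) p).symm v = ((leftTriv I p.1).symm v.1, (leftTriv I p.2).symm v.2) := by
  rw [ContinuousLinearEquiv.symm_apply_eq, leftTriv_prod]
  simp

theorem rightTriv_prod_symm (p : G × G) (v : E × E) :
    (rightTriv (I.prod I) p).symm v =
      ((rightTriv I p.1).symm v.1, (rightTriv I p.2).symm v.2) := by
  rw [ContinuousLinearEquiv.symm_apply_eq, rightTriv_prod]
  simp

/-- A translation of `G × G` is a product of translations of the factors, each of which is an
isometry. -/
theorem IsBiInvariant.prod {h : PseudoRiemannianMetric I G} (hh : IsBiInvariant h) :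
    IsBiInvariant (h.prod h) where
  left a := funext fun p ↦ ContinuousLinearMap.ext fun v ↦ ContinuousLinearMap.ext fun w ↦
    h.prod_inner_prodMap h (mdifferentiable_const_mul a.1) (mdifferentiable_const_mul a.2)
      (fun q v w ↦ congrArg (fun b : E →L[ℝ] E →L[ℝ] ℝ ↦ b v w) (congrFun (hh.left a.1) q))
      (fun q v w ↦ congrArg (fun b : E →L[ℝ] E →L[ℝ] ℝ ↦ b v w) (congrFun (hh.left a.2) q)) p v w
  right a := funext fun p ↦ ContinuousLinearMap.ext fun v ↦ ContinuousLinearMap.ext fun w ↦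
    h.prod_inner_prodMap h (mdifferentiable_mul_const a.1) (mdifferentiable_mul_const a.2)
      (fun q v w ↦ congrArg (fun b : E →L[ℝ] E →L[ℝ] ℝ ↦ b v w) (congrFun (hh.right a.1) q))
      (fun q v w ↦ congrArg (fun b : E →L[ℝ] E →L[ℝ] ℝ ↦ b v w) (congrFun (hh.right a.2) q)) p v w

theorem mdifferentiable_inv_mul (z : G) : MDifferentiable I I fun x : G ↦ x⁻¹ * z := by
  simpa using mdifferentiable_mul_inv_mul (I := I) 1 z

/-- The metric that `x ↦ (x, x⁻¹ z)` induces from `h ⊕ h` is `2 h`. -/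
theorem IsBiInvariant.inner_modelDeriv_graph {h : PseudoRiemannianMetric I G}
    (hh : IsBiInvariant h) (z x : G) (v w : E) :
    (h.prod h).inner (x, x⁻¹ * z)
      (modelDeriv I (I.prod I) (fun x ↦ (x, x⁻¹ * z)) x v : E × E)
      (modelDeriv I (I.prod I) (fun x ↦ (x, x⁻¹ * z)) x w : E × E) =
    2 * h.inner x (v : E) (w : E) := by
  refine (h.prod_inner_apply h _ _ _).trans ?_
  have h1 (β : E →L[ℝ] E →L[ℝ] ℝ) (p q : E) : β (-p) (-q) = β p q := by simp
  have h2 := hh.inner_rightTriv (x⁻¹ * z) (modelDeriv I I (fun x ↦ x⁻¹ * z) x v)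
    (modelDeriv I I (fun x ↦ x⁻¹ * z) x w)
  rw [rightTriv_modelDeriv_inv_mul, rightTriv_modelDeriv_inv_mul] at h2
  rw [modelDeriv_graph (mdifferentiable_inv_mul z), modelDeriv_graph (mdifferentiable_inv_mul z),
    two_mul]
  exact congrArg _ (h2.symm.trans ((h1 _ _ _).trans (hh.inner_leftTriv x v w)))

theorem modelDeriv_neg {f : M → E'} (x : M) (v : E) :
    modelDeriv I 𝓘(ℝ, E') (fun y ↦ -f y) x v = -modelDeriv I 𝓘(ℝ, E') f x v := by
  have h : mvfderiv I (-f) x = -mvfderiv I f x := mvfderiv_neg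
  exact congrArg (fun L : E →L[ℝ] E' ↦ L v) h

/-- The derivative along `x ↦ (x, x⁻¹ z)` of a field that is tangent to this map is tangent. -/
theorem meanConnection_tangent_graph {z : G} (hz : z ∈ Subgroup.center G) {p : G}
    {Y : G × G → E × E} (hY : MDiffFieldAt (I.prod I) Y (p, p⁻¹ * z))
    (hT : ∀ᶠ q in 𝓝 p, ∃ u : E,
      Y (q, q⁻¹ * z) = modelDeriv I (I.prod I) (fun x : G ↦ (x, x⁻¹ * z)) q u) (v : E) :
    ∃ u : E, meanConnection (I.prod I) Y (p, p⁻¹ * z)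
        (modelDeriv I (I.prod I) (fun x : G ↦ (x, x⁻¹ * z)) p v) =
      modelDeriv I (I.prod I) (fun x : G ↦ (x, x⁻¹ * z)) p u := by
  set φ : G → G := fun x ↦ x⁻¹ * z
  have hφ : MDifferentiable I I φ := mdifferentiable_inv_mul z
  set f : G → G × G := fun x ↦ (x, φ x)
  have hf : MDifferentiable I (I.prod I) f := mdifferentiable_id.prodMk hφ
  have hdf (q : G) (u : E) : modelDeriv I (I.prod I) f q u = (u, modelDeriv I I φ q u) :=
    modelDeriv_graph hφ q u
  -- Tangency makes the second component of `Y` along `f` equal to `dφ` of the first, so `a` and `b`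
  -- determine both readings of `Y` near `p`.
  let a : G → E := fun q ↦ leftTriv I q (Y (f q)).1
  let b : G → E := fun q ↦ rightTriv I q (Y (f q)).1
  have hL := isMDiffTrivialization_leftTriv Y (f p) hY
  have hR := isMDiffTrivialization_rightTriv Y (f p) hY
  have hLf := MDifferentiableAt.comp p hL (hf p)
  have hRf := MDifferentiableAt.comp p hR (hf p)
  have ha : MDifferentiableAt I 𝓘(ℝ, E) a p := by
    refine (((ContinuousLinearMap.fst ℝ E E).mdifferentiableAt).comp p hLf).congr_of_eventuallyEq
      (.of_forall fun q ↦ ?_)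
    simp [leftTriv_prod, a, f]
  have hb : MDifferentiableAt I 𝓘(ℝ, E) b p := by
    refine (((ContinuousLinearMap.fst ℝ E E).mdifferentiableAt).comp p hRf).congr_of_eventuallyEq
      (.of_forall fun q ↦ ?_)
    simp [rightTriv_prod, b, f]
  have eL : (fun q ↦ leftTriv (I.prod I) (f q) (Y (f q))) =ᶠ[𝓝 p] fun q ↦ (a q, -b q) := by
    filter_upwards [hT] with q ⟨u, hu⟩
    have hu' : Y (f q) = (u, modelDeriv I I φ q u) := hu.trans (hdf q u)
    simp only [a, b, hu', leftTriv_prod, f]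
    rw [leftTriv_modelDeriv_inv_mul hz]
  have eR : (fun q ↦ rightTriv (I.prod I) (f q) (Y (f q))) =ᶠ[𝓝 p] fun q ↦ (b q, -a q) := by
    filter_upwards [hT] with q ⟨u, hu⟩
    have hu' : Y (f q) = (u, modelDeriv I I φ q u) := hu.trans (hdf q u)
    simp only [a, b, hu', rightTriv_prod, f]
    rw [rightTriv_modelDeriv_inv_mul]
  have dL : modelDeriv (I.prod I) 𝓘(ℝ, E × E) (fun y ↦ leftTriv (I.prod I) y (Y y)) (f p)
      (modelDeriv I (I.prod I) f p v) =
      (modelDeriv I 𝓘(ℝ, E) a p v, -modelDeriv I 𝓘(ℝ, E) b p v) := by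
    have h := congrArg (fun L : E →L[ℝ] E × E ↦ L v) (modelDeriv_comp p hL (hf p))
    rw [modelDeriv_congr eL] at h
    rw [← modelDeriv_neg, ← modelDeriv_prodMk ha (g := fun y ↦ -b y) hb.neg]
    exact h.symm
  have dR : modelDeriv (I.prod I) 𝓘(ℝ, E × E) (fun y ↦ rightTriv (I.prod I) y (Y y)) (f p)
      (modelDeriv I (I.prod I) f p v) =
      (modelDeriv I 𝓘(ℝ, E) b p v, -modelDeriv I 𝓘(ℝ, E) a p v) := by
    have h := congrArg (fun L : E →L[ℝ] E × E ↦ L v) (modelDeriv_comp p hR (hf p))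
    rw [modelDeriv_congr eR] at h
    rw [← modelDeriv_neg, ← modelDeriv_prodMk hb (g := fun y ↦ -a y) ha.neg]
    exact h.symm
  -- The witness is the first component of the covariant derivative. That `dφ` takes it to the
  -- second component follows from `e1` and `e2`, which swap the two summands up to sign.
  refine ⟨(1 / 2 : ℝ) • ((leftTriv I p).symm (modelDeriv I 𝓘(ℝ, E) a p v) +
    (rightTriv I p).symm (modelDeriv I 𝓘(ℝ, E) b p v)), ?_⟩
  have e1 (u : E) : modelDeriv I I φ p ((leftTriv I p).symm u) =
      -(rightTriv I (φ p)).symm u := by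
    rw [← map_neg, ContinuousLinearEquiv.eq_symm_apply, rightTriv_modelDeriv_inv_mul,
      ContinuousLinearEquiv.apply_symm_apply]
  have e2 (u : E) : modelDeriv I I φ p ((rightTriv I p).symm u) =
      -(leftTriv I (φ p)).symm u := by
    rw [← map_neg, ContinuousLinearEquiv.eq_symm_apply, leftTriv_modelDeriv_inv_mul hz,
      ContinuousLinearEquiv.apply_symm_apply]
  rw [hdf p (_ • _), map_smul, map_add, e1, e2]
  change meanConnection (I.prod I) Y (f p) (modelDeriv I (I.prod I) f p v) = _
  rw [meanConnection_apply, flatConnection_apply, flatConnection_apply, dL, dR,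
    leftTriv_prod_symm, rightTriv_prod_symm]
  simp only [f, map_neg, Prod.mk_add_mk, Prod.smul_mk]
  rw [add_comm (-(leftTriv I (φ p)).symm _)]

end Product

/-! ### Totally geodesic embeddings, reparametrization and the case of `SU(2)` -/

section TotallyGeodesic

variable {E : Type*} [NormedAddCommGroup E] [NormedSpace ℝ E]
  {H : Type*} [TopologicalSpace H] {I : ModelWithCorners ℝ E H}
  {M : Type*} [TopologicalSpace M] [ChartedSpace H M] [IsManifold I 1 M]
  {E' : Type*} [NormedAddCommGroup E'] [NormedSpace ℝ E']
  {H' : Type*} [TopologicalSpace H'] {J : ModelWithCorners ℝ E' H'}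
  {N : Type*} [TopologicalSpace N] [ChartedSpace H' N]
  {N' : Type*} [TopologicalSpace N'] [ChartedSpace H' N']

theorem IsTotallyGeodesic.isMinimal {g : PseudoRiemannianMetric I M} {f : N → M}
    (h : IsTotallyGeodesic J g f) : IsMinimal J g f := by
  obtain ⟨h1, D, hD, hB⟩ := h
  exact ⟨h1, D, _, hD, hB, fun _ _ _ _ ↦ Finset.sum_const_zero⟩

/-- Since `dφ` is invertible, `f` and `f ∘ φ` have the same tangent spaces along the image, and the
conditions on the metric and on covariant derivatives depend only on these. -/
theorem IsTotallyGeodesic.comp_diffeomorph [IsManifold J ∞ N] [IsManifold J ∞ N']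
    {g : PseudoRiemannianMetric I M} {f : N → M}
    (h : IsTotallyGeodesic J g f) (φ : Diffeomorph J J N' N ∞) :
    IsTotallyGeodesic J g (f ∘ φ) := by
  obtain ⟨⟨hemb, hnd⟩, D, hD, -, hgauss⟩ := h
  have hf : MDifferentiable J I f := hemb.contMDiff.mdifferentiable (by norm_num)
  have hφ : MDifferentiable J J φ := φ.contMDiff.mdifferentiable (by norm_num)
  have hψ : MDifferentiable J J φ.symm := φ.symm.contMDiff.mdifferentiable (by norm_num)
  have hd (p : N') (v : E') : modelDeriv J I (f ∘ φ) p v =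
      modelDeriv J I f (φ p) (modelDeriv J J φ p v) :=
    (modelDeriv_comp_apply hf hφ rfl v).symm
  have hφψ (p : N') (v : E') : modelDeriv J J φ p (modelDeriv J J φ.symm (φ p) v) = v := by
    rw [modelDeriv_comp_apply hφ hψ (φ.symm_apply_apply p)]
    simp [modelDeriv_id]
  have hψφ (p : N') (v : E') : modelDeriv J J φ.symm (φ p) (modelDeriv J J φ p v) = v := by
    rw [modelDeriv_comp_apply hψ hφ rfl]
    simp [modelDeriv_id]
  have hd' (p : N') (v : E') : modelDeriv J I (f ∘ φ) p (modelDeriv J J φ.symm (φ p) v) =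
      modelDeriv J I f (φ p) v := by
    rw [hd, hφψ]
  refine ⟨⟨hemb.comp_diffeomorph φ, fun p v hv ↦ ?_⟩, D, hD, ⟨fun p v w u ↦ ?_, ?_⟩⟩
  · have h0 : modelDeriv J J φ p v = 0 := by
      refine hnd (φ p) (modelDeriv J J φ p v) fun w ↦ ?_
      exact (congrArg₂ (fun a b : E ↦ g.inner (f (φ p)) a b) (hd p v) (hd' p w)).symm.trans (hv _)
    have h1 := hψφ p v
    rw [h0, map_zero] at h1
    exact h1.symm
  · exact congrArg (fun L : E →L[ℝ] ℝ ↦ L (modelDeriv J I (f ∘ φ) p u)) (map_zero _)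
  · intro p v w Y hY hT hYw
    have hT' : ∀ᶠ q in 𝓝 (φ p), ∃ u : TangentSpace J q, Y (f q) = mfderiv J I f q u := by
      have hc := φ.symm.continuous.tendsto (φ p)
      rw [φ.symm_apply_apply] at hc
      filter_upwards [hc.eventually hT] with q ⟨u, hu⟩
      refine ⟨modelDeriv J J φ (φ.symm q) u, ?_⟩
      have h1 : (Y (f (φ (φ.symm q))) : E) =
        modelDeriv J I f (φ (φ.symm q)) (modelDeriv J J φ (φ.symm q) u) := hu.trans (hd _ _)
      rw [φ.apply_symm_apply] at h1
      exact h1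
    obtain ⟨u, hu⟩ := hgauss (φ p) (modelDeriv J J φ p v) (modelDeriv J J φ p w) Y hY hT'
      (hYw.trans (hd p w))
    refine ⟨modelDeriv J J φ.symm (φ p) u, ?_⟩
    refine (congrArg (D Y (f (φ p))) (hd p v)).trans (hu.trans ?_)
    exact congrArg (· + 0) (hd' p u).symm

/-- For central `z` the map `x ↦ (x, x⁻¹ z)` is a totally geodesic embedding of `G` into `G × G`. -/
theorem IsBiInvariant.isTotallyGeodesic_inv_mul [FiniteDimensional ℝ E] {G : Type*}
    [TopologicalSpace G] [ChartedSpace E G] [Group G] [LieGroup 𝓘(ℝ, E) ∞ G]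
    {h : PseudoRiemannianMetric 𝓘(ℝ, E) G} (hh : IsBiInvariant h) {z : G}
    (hz : z ∈ Subgroup.center G) :
    IsTotallyGeodesic 𝓘(ℝ, E) (h.prod h) fun x : G ↦ (x, x⁻¹ * z) := by
  refine ⟨⟨isSmoothEmbedding_inv_mul z, fun p v hv ↦ ?_⟩, _, hh.prod.isLeviCivita,
    fun p v w u ↦ ?_, fun p v w Y hY hT hYw ↦ ?_⟩
  · refine h.nondegenerate p v fun w ↦ ?_
    have h1 := (hh.inner_modelDeriv_graph z p v w).symm.trans (hv w)
    exact (mul_eq_zero.1 h1).resolve_left two_ne_zero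
  · exact congrArg (fun L : E × E →L[ℝ] ℝ ↦ L _) (map_zero _)
  · obtain ⟨u, hu⟩ := meanConnection_tangent_graph hz
      (hY.mdifferentiableAt (by norm_num) : MDiffFieldAt (𝓘(ℝ, E).prod 𝓘(ℝ, E)) Y _) hT v
    exact ⟨u, hu.trans (add_zero _).symm⟩

/-- `S³` and `SU(2)` are diffeomorphic. -/
noncomputable def SU2.diffeomorphSphere : Diffeomorph (𝓡 3) (𝓡 3) S3 SU2 ∞ where
  toEquiv := SU2.homeoSphere.symm.toEquiv
  contMDiff_toFun := SU2.contMDiff_homeoSphere_symm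
  contMDiff_invFun := SU2.contMDiff_homeoSphere

theorem SU2.negOne_mem_center : SU2.negOne ∈ Subgroup.center SU2 := by
  rw [Subgroup.mem_center_iff]
  intro A
  apply Subtype.ext
  simp [SU2.negOne]

end TotallyGeodesic

/-! ### The main theorem -/

theorem mainTheorem4 :
    (∀ (E : Type u) [NormedAddCommGroup E] [NormedSpace ℝ E] [FiniteDimensional ℝ E]
      (G : Type v) [TopologicalSpace G] [ChartedSpace E G] [Group G] [LieGroup 𝓘(ℝ, E) ∞ G]
      (h : PseudoRiemannianMetric 𝓘(ℝ, E) G), IsBiInvariant h →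
      ∀ z ∈ Subgroup.center G,
        twistedConjClass ((1, z) : G × G) = (fun p : G × G ↦ p.1 * p.2) ⁻¹' {z} ∧
        twistedConjClass ((1, z) : G × G) = (fun p ↦ (1, z) * p) '' antiDiagonal G ∧
        twistedConjClass ((1, z) : G × G) = (fun p ↦ p * (1, z)) '' antiDiagonal G ∧
        Set.range (fun x : G ↦ (x, x⁻¹ * z)) = twistedConjClass ((1, z) : G × G) ∧
        IsBiInvariant (h.prod h) ∧
        IsTotallyGeodesic 𝓘(ℝ, E) (h.prod h) (fun x : G ↦ (x, x⁻¹ * z)) ∧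
        IsMinimal 𝓘(ℝ, E) (h.prod h) (fun x : G ↦ (x, x⁻¹ * z))) ∧
    (∀ h : PseudoRiemannianMetric (𝓡 3) SU2, IsBiInvariant h →
      ∀ z ∈ ({1, SU2.negOne} : Set SU2),
        ∃ f : S3 → SU2 × SU2, Set.range f = twistedConjClass (1, z) ∧
          IsTotallyGeodesic (𝓡 3) (h.prod h) f ∧ IsMinimal (𝓡 3) (h.prod h) f) := by
  refine ⟨fun E _ _ _ G _ _ _ _ h hh z hz ↦ ?_, fun h hh z hz ↦ ?_⟩
  · have h1 := (range_inv_mul_eq_preimage z).trans (twistedConjClass_one_eq_preimage hz).symm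
    exact ⟨twistedConjClass_one_eq_preimage hz,
      h1.symm.trans (range_inv_mul_eq_image_mul_left hz),
      h1.symm.trans (range_inv_mul_eq_image_mul_right z), h1, hh.prod,
      hh.isTotallyGeodesic_inv_mul hz, (hh.isTotallyGeodesic_inv_mul hz).isMinimal⟩
  · have hz' : z ∈ Subgroup.center SU2 := by
      rcases hz with rfl | rfl
      exacts [one_mem _, SU2.negOne_mem_center]
    have h1 := (hh.isTotallyGeodesic_inv_mul hz').comp_diffeomorph SU2.diffeomorphSphere
    refine ⟨_, ?_, h1, h1.isMinimal⟩
    rw [(EquivLike.surjective SU2.diffeomorphSphere).range_comp, range_inv_mul_eq_preimage,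
      twistedConjClass_one_eq_preimage hz']
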